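/- Let $1<p<\infty$ and let $q$ be the conjugate index, $\frac1p+\frac1q=1$. A weight on $\mathbb R$ is a Borel measurable map $\omega:\mathbb R\to[1,\infty)$ with $\omega(x+y)\le\omega(x)\omega(y)$ for all $x,y\in\mathbb R$; put $\rho_{1,\omega}=\sup\{\log(\omega(x)^{1/x}):x<0\}$ and $\rho_{2,\omega}=\inf\{\log(\omega(x)^{1/x}):x>0\}$. A weight is admissible if $\rho_{1,\omega}=0=\rho_{2,\omega}$. A weight $\omega$ is an almost monotone algebra weight if: (1) $\int_{\mathbb R}\omega(y)^{-q}\omega(x-y)^{-q}\,dy\le\omega(x)^{-q}$ for all $x\in\mathbb R$ and $\int_{\mathbb R}\omega(x)^{-q}\,dx<\infty$; (2) if $\rho_{1,\omega}=0$, there is $K>0$ with $\omega(x)\le K\omega(x+y)$ for all $x,y\le0$; (3) if $\rho_{2,\omega}=0$, there is $K>0$ with $\omega(x)\le K\omega(x+y)$ for all $x,y\ge0$. Let $\mathcal A$ be a complex unital Banach algebra with unit $\mathbf e$. For a weight $\omega$, let $L^p(\mathbb R,\omega,\mathcal A)$ be the space of (a.e. classes of) strongly measurable $f:\mathbb R\to\mathcal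 A$ with $\int_{\mathbb R}\|f(x)\|^p\omega(x)^p\,dx<\infty$. When $\omega$ is an almost monotone algebra weight, this is an algebra under convolution $(f\star g)(x)=\int_{\mathbb R}f(y)g(x-y)\,dy$; its unitization $L^p(\mathbb R,\omega,\mathcal A)_{\mathbf 1}$ consists of the elements $a+\alpha\mathbf 1$ with $a\in L^p(\mathbb R,\omega,\mathcal A)$, $\alpha\in\mathbb C$, with product $(a+\alpha\mathbf 1)(b+\beta\mathbf 1)=(a\star b+\alpha b+\beta a)+\alpha\beta\mathbf 1$. Theorem. Let $\omega$ be an almost monotone algebra weight on $\mathbb R$ and let $f\in L^p(\mathbb R,\omega,\mathcal A)$ be such that $\mathbf e+\int_{\mathbb R}f(x)e^{itx}\,dx$ is left invertible (respectively, right invertible, invertible) in $\mathcal A$ for all $t\in\mathbb R$. Then there are an almost monotone algebra weight $\nu$ on $\mathbb R$ and $g\in L^p(\mathbb R,\nu,\mathcal A)$ such that $1\le\nu\le K\omega$ for some $K>0$ and $\mathbf 1+g$ is a left inverse (respectively, right inverse, inverse) of $\mathbf 1+f$ in $L^p(\mathbb R,\nu,\mathcal A)_{\mathbf 1}$. In particular,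 if $\omega$ is admissible, then $\mathbf 1+f$ is left invertible (respectively, right invertible, invertible) in $L^p(\mathbb R,\omega,\mathcal A)_{\mathbf 1}$. -/

import Mathlib

open MeasureTheory Filter

open scoped Convolution

noncomputable section

namespace WienerLp

/-- A weight on `ℝ`: a Borel measurable map into `[1,∞)` that is submultiplicative
with respect to addition. -/
structure IsWeight (ω : ℝ → ℝ) : Prop where
  measurable : Measurable ω
  one_le : ∀ x, 1 ≤ ω x
  map_add_le : ∀ x y, ω (x + y) ≤ ω x * ω y

/-- `ρ₁(ω) = sup {log (ω(x)^(1/x)) : x < 0}`. For a weight the set is nonempty and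
bounded above by `0`. -/
def rho₁ (ω : ℝ → ℝ) : ℝ := sSup ((fun x : ℝ => Real.log (ω x ^ (1 / x))) '' Set.Iio 0)

/-- `ρ₂(ω) = inf {log (ω(x)^(1/x)) : x > 0}`. For a weight the set is nonempty and
bounded below by `0`. -/
def rho₂ (ω : ℝ → ℝ) : ℝ := sInf ((fun x : ℝ => Real.log (ω x ^ (1 / x))) '' Set.Ioi 0)

/-- A weight is admissible if `ρ₁ = 0 = ρ₂`. -/
def IsAdmissible (ω : ℝ → ℝ) : Prop := rho₁ ω = 0 ∧ rho₂ ω = 0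

/-- Almost monotone algebra weights, relative to the exponent `q` conjugate to `p`. -/
structure IsAlmostMonotoneAlgebraWeight (q : ℝ) (ω : ℝ → ℝ) : Prop extends IsWeight ω where
  /-- `ω^{-q} ⋆ ω^{-q} ≤ ω^{-q}` -/
  conv_le : ∀ x, ∫⁻ y, ENNReal.ofReal (ω y ^ (-q)) * ENNReal.ofReal (ω (x - y) ^ (-q)) ≤
    ENNReal.ofReal (ω x ^ (-q))
  /-- `∫ ω^{-q} < ∞` -/
  lintegral_lt_top : ∫⁻ x, ENNReal.ofReal (ω x ^ (-q)) < ⊤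
  almost_monotone_neg : rho₁ ω = 0 → ∃ K > 0, ∀ x ≤ 0, ∀ y ≤ 0, ω x ≤ K * ω (x + y)
  almost_monotone_pos : rho₂ ω = 0 → ∃ K > 0, ∀ x ≥ 0, ∀ y ≥ 0, ω x ≤ K * ω (x + y)

/-- Membership in `L^p(ℝ, ω, A)`: `f` is (Bochner) measurable and
`∫ ‖f(x)‖^p ω(x)^p dx < ∞`. -/
def MemWeightedLp {A : Type*} [NormedRing A] (p : ℝ) (ω : ℝ → ℝ) (f : ℝ → A) : Prop :=
  AEStronglyMeasurable f volume ∧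
    ∫⁻ x, ENNReal.ofReal (‖f x‖ ^ p * ω x ^ p) < ⊤

/-- The convolution `(f ⋆ g)(x) = ∫ f(y) g(x - y) dy` of `A`-valued functions on `ℝ`. -/
def conv {A : Type*} [NormedRing A] [NormedAlgebra ℂ A] (f g : ℝ → A) : ℝ → A :=
  f ⋆[ContinuousLinearMap.mul ℂ A, volume] g

/-- Elements `a + α𝟏` of the unitization of `L^p(ℝ, ω, A)` are represented by pairs `(a, α)` with
`a` in `L^p(ℝ, ω, A)`. -/
def MemUnitization {A : Type*} [NormedRing A] (p : ℝ) (ω : ℝ → ℝ) (u : (ℝ → A) × ℂ) : Prop :=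
  MemWeightedLp p ω u.1

/-- The product `(a + α𝟏)(b + β𝟏) = (a ⋆ b + αb + βa) + αβ𝟏` of the unitization. -/
def unitMul {A : Type*} [NormedRing A] [NormedAlgebra ℂ A] (u v : (ℝ → A) × ℂ) : (ℝ → A) × ℂ :=
  (conv u.1 v.1 + u.2 • v.1 + v.2 • u.1, u.2 * v.2)

/-- Two pairs represent the same element of the unitization: the function parts agree almost
everywhere and the scalar parts agree. -/
def UnitEq {A : Type*} [NormedRing A] (u v : (ℝ → A) × ℂ) : Prop :=
  u.1 =ᵐ[volume] v.1 ∧ u.2 = v.2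

/-- The unit `𝟏` of the unitization. -/
def unitOne (A : Type*) [NormedRing A] : (ℝ → A) × ℂ := (0, 1)

/-- `u` is a left inverse of `v`, that is, `u v = 𝟏` in the unitization. -/
def IsLeftInv {A : Type*} [NormedRing A] [NormedAlgebra ℂ A] (u v : (ℝ → A) × ℂ) : Prop :=
  UnitEq (unitMul u v) (unitOne A)

/-- `u` is a right inverse of `v`, that is, `v u = 𝟏` in the unitization. -/
def IsRightInv {A : Type*} [NormedRing A] [NormedAlgebra ℂ A] (u v : (ℝ → A) × ℂ) : Prop :=
  UnitEq (unitMul v u) (unitOne A)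

/-- `u` is a two-sided inverse of `v` in the unitization. -/
def IsTwoSidedInv {A : Type*} [NormedRing A] [NormedAlgebra ℂ A] (u v : (ℝ → A) × ℂ) : Prop :=
  IsLeftInv u v ∧ IsRightInv u v

/-- The element `𝟏 + f` of the unitization. -/
def onePlus {A : Type*} [NormedRing A] (f : ℝ → A) : (ℝ → A) × ℂ := (f, 1)

/-- The element `e + ∫ f(x) e^{itx} dx` of `A`. -/
def symbol {A : Type*} [NormedRing A] [NormedAlgebra ℂ A] (f : ℝ → A) (t : ℝ) : A :=
  1 + ∫ x : ℝ, Complex.exp (Complex.I * t * x) • f x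

end WienerLp

end

/-! In `L¹(ℝ, A)` the statement is Wiener's lemma with an `A`-valued symbol
(`exists_leftInverse_L1`). A left inverse `𝟏 + g` of `𝟏 + f` solves `g + g ⋆ f = -f`, so a right
inverse of `1 + rconv f` among the bounded operators on `L¹` is enough. Convolution by scalar
kernels commutes with `rconv f` and localises in frequency: near a finite frequency `f` acts almost
as right multiplication by the value of its Fourier integral there, and near infinity almost as
zero. Neumann series invert these local models, and finitely many of them are patched together.

The `L¹` solution `g₀` carries no weighted information. It is approximated in `L¹` by a continuous
compactly supported `g₁`; then `(𝟏 + g₁)(𝟏 + f) = 𝟏 + r` with `r` in `L^p(ω)` and `‖r‖₁ < 1`. If `𝟏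
+ h` is a left inverse of `𝟏 + r`, then `(𝟏 + h)(𝟏 + g₁)` is one of `𝟏 + f`. From `|h| ≤ |r| + |r| ⋆
|h|`, the function `|h|` is dominated by the sum of the convolution powers of `|r|`. That sum
converges in `L^p(ν)` when `ν` has small exponential growth (`wnorm_lt_top_of_le`): the part of
`|r|` on `[-N, N]` acts with norm close to `‖r‖₁`, and the rest has small weighted norm.

Weights `ν ≤ Kω` of arbitrarily small exponential growth, with `K` independent of the growth rate,
come from `exists_small_weights`: on each half-line `ω` is kept if its rate there is zero and
replaced by `e^{ε|x|}(1 + |x|)²` otherwise, up to a constant factor. For admissible `ω` nothing is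
replaced, so `ν` is comparable to `ω`. Right inverses come from the opposite algebra, and two-sided
ones from the equality of left and right inverses. -/

open MeasureTheory Filter

open scoped Convolution

noncomputable section

namespace WienerLp

/-! ### Convolution of integrable algebra-valued functions. -/

section Convolution

variable {A : Type*} [NormedRing A] [NormedAlgebra ℂ A]

theorem conv_apply (f g : ℝ → A) (x : ℝ) : conv f g x = ∫ y, f y * g (x - y) := rfl

theorem enorm_conv_le (f g : ℝ → A) (x : ℝ) :
    ‖conv f g x‖ₑ ≤ ∫⁻ y, ‖f y‖ₑ * ‖g (x - y)‖ₑ := by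
  rw [conv_apply]
  exact (enorm_integral_le_lintegral_enorm _).trans (lintegral_mono fun y => by
    rw [enorm_eq_nnnorm, enorm_eq_nnnorm, enorm_eq_nnnorm, ← ENNReal.coe_mul]
    exact ENNReal.coe_le_coe.2 (nnnorm_mul_le _ _))

/-- The `L¹`-norm of a convolution of nonnegative functions. -/
theorem lintegral_lintegral_mul_sub {u v : ℝ → ENNReal} (hu : AEMeasurable u)
    (hv : AEMeasurable v) :
    ∫⁻ x, ∫⁻ y, u y * v (x - y) = (∫⁻ y, u y) * ∫⁻ x, v x := by
  have h : AEMeasurable (Function.uncurry fun x y : ℝ => u y * v (x - y))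
      (volume.prod volume) := by
    refine (hu.comp_quasiMeasurePreserving Measure.quasiMeasurePreserving_snd).mul ?_
    exact hv.comp_quasiMeasurePreserving (quasiMeasurePreserving_sub volume volume)
  rw [lintegral_lintegral_swap h]
  have : ∀ y : ℝ, ∫⁻ x, u y * v (x - y) = u y * ∫⁻ x, v x := fun y => by
    have hv' : AEMeasurable fun x => v (x - y) := hv.comp_quasiMeasurePreserving
      (measurePreserving_sub_right volume y).quasiMeasurePreserving
    rw [lintegral_const_mul'' _ hv', lintegral_sub_right_eq_self v y]
  simp_rw [this]
  rw [lintegral_mul_const'' _ hu]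

theorem integrable_conv {f g : ℝ → A} (hf : Integrable f) (hg : Integrable g) :
    Integrable (conv f g) := hf.integrable_convolution _ hg

theorem lintegral_enorm_conv_le {f g : ℝ → A} (hf : AEStronglyMeasurable f)
    (hg : AEStronglyMeasurable g) :
    ∫⁻ x, ‖conv f g x‖ₑ ≤ (∫⁻ x, ‖f x‖ₑ) * ∫⁻ x, ‖g x‖ₑ := by
  rw [← lintegral_lintegral_mul_sub hf.enorm hg.enorm]
  exact lintegral_mono fun x => enorm_conv_le f g x

theorem conv_congr {f f' g g' : ℝ → A} (hf : f =ᵐ[volume] f') (hg : g =ᵐ[volume] g') :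
    conv f g = conv f' g' := convolution_congr _ hf hg

theorem conv_add {f g h : ℝ → A} (hf : Integrable f) (hg : Integrable g) (hh : Integrable h) :
    conv f (g + h) =ᵐ[volume] conv f g + conv f h := by
  filter_upwards [hf.ae_convolution_exists (ContinuousLinearMap.mul ℂ A) hg,
    hf.ae_convolution_exists (ContinuousLinearMap.mul ℂ A) hh] with x hx hx'
  exact hx.distrib_add hx'

theorem add_conv {f g h : ℝ → A} (hf : Integrable f) (hg : Integrable g) (hh : Integrable h) :
    conv (f + g) h =ᵐ[volume] conv f h + conv g h := by
  filter_upwards [hf.ae_convolution_exists (ContinuousLinearMap.mul ℂ A) hh,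
    hg.ae_convolution_exists (ContinuousLinearMap.mul ℂ A) hh] with x hx hx'
  exact hx.add_distrib hx'

theorem conv_smul (c : ℂ) (f g : ℝ → A) : conv f (c • g) = c • conv f g :=
  convolution_smul

theorem smul_conv (c : ℂ) (f g : ℝ → A) : conv (c • f) g = c • conv f g :=
  smul_convolution

theorem conv_assoc [CompleteSpace A] {f g h : ℝ → A} (hf : Integrable f) (hg : Integrable g)
    (hh : Integrable h) : conv (conv f g) h =ᵐ[volume] conv f (conv g h) := by
  have h1 := hf.ae_convolution_exists (ContinuousLinearMap.mul ℂ A) hg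
  have h2 := hg.norm.ae_convolution_exists (ContinuousLinearMap.mul ℝ ℝ) hh.norm
  have h3 := hf.norm.ae_convolution_exists (ContinuousLinearMap.mul ℝ ℝ)
    (hg.norm.integrable_convolution (ContinuousLinearMap.mul ℝ ℝ) hh.norm)
  filter_upwards [h3] with x hx
  exact convolution_assoc _ _ _ _ (fun a b c => by simp [mul_assoc]) hf.aestronglyMeasurable
    hg.aestronglyMeasurable hh.aestronglyMeasurable h1 h2 hx

end Convolution

/-! ### Operators on `L¹(ℝ, A)`: right convolution, right multiplication, scalar kernels. -/

section L1

variable (A : Type*) [NormedRing A]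

/-- The space `L¹(ℝ, A)`. -/
abbrev L1 := Lp A 1 (volume : Measure ℝ)

variable {A}

theorem L1.integrable (f : L1 A) : Integrable f := L1.integrable_coeFn f

theorem L1.norm_le_of_lintegral_le {f : L1 A} {C : ℝ} (hC : 0 ≤ C)
    (h : ∫⁻ x, ‖f x‖ₑ ≤ ENNReal.ofReal C) : ‖f‖ ≤ C := by
  rw [L1.norm_def]
  exact ENNReal.toReal_le_of_le_ofReal hC h

theorem L1.ofReal_norm (f : L1 A) : ENNReal.ofReal ‖f‖ = ∫⁻ x, ‖f x‖ₑ :=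
  L1.ofReal_norm_eq_lintegral f

variable [NormedAlgebra ℂ A]

/-- The convolution on `L¹(ℝ, A)`. -/
def convL1 : L1 A →ₗ[ℂ] L1 A →ₗ[ℂ] L1 A :=
  LinearMap.mk₂ ℂ (fun f g => (integrable_conv (L1.integrable f) (L1.integrable g)).toL1 _)
      (fun f g h => by
        refine Lp.ext ?_
        refine (Integrable.coeFn_toL1 _).trans ?_
        rw [conv_congr (Lp.coeFn_add f g) (ae_eq_refl h)]
        refine (add_conv (L1.integrable f) (L1.integrable g) (L1.integrable h)).trans ?_
        exact ((Integrable.coeFn_toL1 _).symm.add (Integrable.coeFn_toL1 _).symm).trans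
          (Lp.coeFn_add _ _).symm)
      (fun c f g => by
        refine Lp.ext ?_
        refine (Integrable.coeFn_toL1 _).trans ?_
        rw [conv_congr (Lp.coeFn_smul c f) (ae_eq_refl g), smul_conv]
        exact ((Integrable.coeFn_toL1 _).symm.const_smul c).trans (Lp.coeFn_smul _ _).symm)
      (fun f g h => by
        refine Lp.ext ?_
        refine (Integrable.coeFn_toL1 _).trans ?_
        rw [conv_congr (ae_eq_refl f) (Lp.coeFn_add g h)]
        refine (conv_add (L1.integrable f) (L1.integrable g) (L1.integrable h)).trans ?_
        exact ((Integrable.coeFn_toL1 _).symm.add (Integrable.coeFn_toL1 _).symm).trans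
          (Lp.coeFn_add _ _).symm)
      (fun c f g => by
        refine Lp.ext ?_
        refine (Integrable.coeFn_toL1 _).trans ?_
        rw [conv_congr (ae_eq_refl f) (Lp.coeFn_smul c g), conv_smul]
        exact ((Integrable.coeFn_toL1 _).symm.const_smul c).trans (Lp.coeFn_smul _ _).symm)

theorem coeFn_convL1 (f g : L1 A) : convL1 f g =ᵐ[volume] conv f g :=
  Integrable.coeFn_toL1 (integrable_conv (L1.integrable f) (L1.integrable g))

theorem norm_convL1_le (f g : L1 A) : ‖convL1 f g‖ ≤ ‖f‖ * ‖g‖ := by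
  refine L1.norm_le_of_lintegral_le (by positivity) ?_
  rw [ENNReal.ofReal_mul (norm_nonneg _), L1.ofReal_norm, L1.ofReal_norm]
  refine (lintegral_congr_ae (EventuallyEq.fun_comp (coeFn_convL1 f g) (‖·‖ₑ))).le.trans ?_
  exact lintegral_enorm_conv_le (L1.integrable f).1 (L1.integrable g).1

theorem convL1_assoc [CompleteSpace A] (f g h : L1 A) :
    convL1 (convL1 f g) h = convL1 f (convL1 g h) := by
  refine Lp.ext ?_
  refine (coeFn_convL1 _ _).trans (EventuallyEq.trans ?_ (coeFn_convL1 _ _).symm)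
  rw [conv_congr (coeFn_convL1 f g) (ae_eq_refl h), conv_congr (ae_eq_refl f) (coeFn_convL1 g h)]
  exact conv_assoc (L1.integrable f) (L1.integrable g) (L1.integrable h)

/-- Right convolution by `f`, as an operator on `L¹(ℝ, A)`. -/
def rconv (f : L1 A) : L1 A →L[ℂ] L1 A :=
  (convL1.flip f).mkContinuous ‖f‖ fun h => by
    rw [mul_comm]
    exact norm_convL1_le h f

@[simp] theorem rconv_apply (f h : L1 A) : rconv f h = convL1 h f := rfl

theorem norm_rconv_le (f : L1 A) : ‖rconv f‖ ≤ ‖f‖ :=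
  LinearMap.mkContinuous_norm_le _ (norm_nonneg _) _

theorem rconv_sub (f g : L1 A) : rconv (f - g) = rconv f - rconv g := by
  ext1 h
  simp

/-- Pointwise right multiplication by `a`, as an operator on `L¹(ℝ, A)`. -/
def rmul (a : A) : L1 A →L[ℂ] L1 A :=
  ((ContinuousLinearMap.mul ℂ A).flip a).compLpL 1 volume

theorem coeFn_rmul (a : A) (h : L1 A) : rmul a h =ᵐ[volume] fun x => h x * a :=
  ContinuousLinearMap.coeFn_compLpL _ h

theorem rmul_one : rmul (1 : A) = 1 := by
  ext1 h
  refine Lp.ext ((coeFn_rmul 1 h).trans ?_)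
  simp

theorem rmul_add (a b : A) : rmul (a + b) = rmul a + rmul b := by
  ext1 h
  refine Lp.ext ((coeFn_rmul _ h).trans ?_)
  refine EventuallyEq.trans ?_ (Lp.coeFn_add (rmul a h) (rmul b h)).symm
  filter_upwards [coeFn_rmul a h, coeFn_rmul b h] with x hx hx'
  simp [hx, hx', mul_add]

theorem rmul_mul_rmul (a b : A) : rmul a * rmul b = rmul (b * a) := by
  ext1 h
  refine Lp.ext ((coeFn_rmul a (rmul b h)).trans ?_)
  filter_upwards [coeFn_rmul b h, coeFn_rmul (b * a) h] with x hx hx'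
  rw [hx, hx', mul_assoc]

/-- The function `x ↦ u(x) a` as an element of `L¹(ℝ, A)`. -/
def scalarL1 {u : ℝ → ℂ} (hu : Integrable u) (a : A) : L1 A := (hu.smul_const a).toL1 _

theorem coeFn_scalarL1 {u : ℝ → ℂ} (hu : Integrable u) (a : A) :
    scalarL1 hu a =ᵐ[volume] fun x => u x • a := Integrable.coeFn_toL1 _

theorem scalarL1_add {u v w : ℝ → ℂ} (hu : Integrable u) (hv : Integrable v) (hw : Integrable w)
    (h : ∀ x, w x = u x + v x) (a : A) : scalarL1 hw a = scalarL1 hu a + scalarL1 hv a := by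
  refine Lp.ext ((coeFn_scalarL1 hw a).trans (EventuallyEq.trans ?_ (Lp.coeFn_add _ _).symm))
  filter_upwards [coeFn_scalarL1 hu a, coeFn_scalarL1 hv a] with x h1 h2
  rw [Pi.add_apply, h1, h2, h, add_smul]

theorem convL1_scalarL1_comm {u : ℝ → ℂ} (hu : Integrable u) (f : L1 A) :
    convL1 (scalarL1 hu 1) f = convL1 f (scalarL1 hu 1) := by
  refine Lp.ext ((coeFn_convL1 _ _).trans (EventuallyEq.trans ?_ (coeFn_convL1 _ _).symm))
  rw [conv_congr (coeFn_scalarL1 hu 1) (ae_eq_refl f),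
    conv_congr (ae_eq_refl f) (coeFn_scalarL1 hu 1)]
  refine Eventually.of_forall fun x => ?_
  rw [conv_apply, ← integral_sub_left_eq_self _ volume x, conv_apply]
  simp

/-- The kernel is scalar, so its constant factor `a` can be moved onto `f`. This ties `rmul a` to
convolution operators. -/
theorem convL1_scalarL1 {u : ℝ → ℂ} (hu : Integrable u) (f : L1 A) (a : A) :
    convL1 f (scalarL1 hu a) = convL1 (rmul a f) (scalarL1 hu 1) := by
  refine Lp.ext ((coeFn_convL1 _ _).trans (EventuallyEq.trans ?_ (coeFn_convL1 _ _).symm))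
  rw [conv_congr (ae_eq_refl f) (coeFn_scalarL1 hu a),
    conv_congr (coeFn_rmul a f) (coeFn_scalarL1 hu 1)]
  refine Eventually.of_forall fun x => ?_
  simp [conv_apply]

/-- Convolution by a scalar function, as an operator on `L¹(ℝ, A)`. -/
def sconv {u : ℝ → ℂ} (hu : Integrable u) : L1 A →L[ℂ] L1 A := rconv (scalarL1 hu 1)

theorem sconv_mul_rconv [CompleteSpace A] {u : ℝ → ℂ} (hu : Integrable u) (f : L1 A) :
    sconv hu * rconv f = rconv f * sconv hu := by
  ext1 h
  change convL1 (convL1 h f) (scalarL1 hu 1) = convL1 (convL1 h (scalarL1 hu 1)) f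
  rw [convL1_assoc, convL1_assoc, convL1_scalarL1_comm]

theorem sconv_mul_sconv [CompleteSpace A] {u v w : ℝ → ℂ} (hu : Integrable u)
    (hv : Integrable v) (hw : Integrable w)
    (huv : ∀ x, ∫ y, v y * u (x - y) = w x) :
    sconv (A := A) hu * sconv hv = sconv hw := by
  ext1 h
  change convL1 (convL1 h (scalarL1 hv 1)) (scalarL1 hu 1) = convL1 h (scalarL1 hw 1)
  rw [convL1_assoc]
  congr 1
  refine Lp.ext ((coeFn_convL1 _ _).trans (EventuallyEq.trans ?_ (coeFn_scalarL1 _ _).symm))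
  rw [conv_congr (coeFn_scalarL1 hv 1) (coeFn_scalarL1 hu 1)]
  refine Eventually.of_forall fun x => ?_
  change _ = w x • (1 : A)
  rw [conv_apply, ← huv, ← integral_smul_const]
  simp [smul_smul, mul_comm]

/-- The difference `rconv f - rmul a` need not be small, but once localised by a scalar kernel it is
again a right convolution, so its operator norm is at most an `L¹` norm. -/
theorem sconv_mul_sub [CompleteSpace A] {u : ℝ → ℂ} (hu : Integrable u) (f : L1 A) (a : A) :
    sconv hu * (rconv f - rmul a) = rconv (convL1 f (scalarL1 hu 1) - scalarL1 hu a) := by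
  ext1 h
  change convL1 (convL1 h f - rmul a h) (scalarL1 hu 1) = convL1 h _
  rw [map_sub, map_sub, LinearMap.sub_apply, convL1_assoc, convL1_scalarL1 hu h a]

end L1

/-! ### Continuity of translations in `L¹`. -/

section Translation

variable {E F : Type*} [NormedAddCommGroup E] [NormedAddCommGroup F]

open Topology

/-- Translations are continuous in `L¹`. -/
theorem tendsto_lintegral_translation {g : ℝ → E} (hg : Integrable g) :
    Tendsto (fun s : ℝ => ∫⁻ x, ‖g (x - s) - g x‖ₑ) (𝓝 0) (𝓝 0) := by
  let T : C(ℝ, C(ℝ, ℝ)) := ContinuousMap.curry ⟨fun z : ℝ × ℝ => z.2 - z.1, by fun_prop⟩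
  have hT : ∀ s, MeasurePreserving (T s) volume volume := fun s =>
    measurePreserving_sub_right volume s
  let G := hg.toL1 g
  have h : Continuous fun s => Lp.compMeasurePreserving (T s) (hT s) G :=
    Continuous.compMeasurePreservingLp continuous_const T.continuous hT ENNReal.one_ne_top
  have h0 := (h.edist
    (continuous_const (y := Lp.compMeasurePreserving (T 0) (hT 0) G))).tendsto 0
  simp only [edist_self] at h0
  refine h0.congr fun s => ?_
  rw [Lp.edist_def, eLpNorm_one_eq_lintegral_enorm]
  have hs : ∀ s, Lp.compMeasurePreserving (T s) (hT s) G =ᵐ[volume] fun x => g (x - s) :=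
    fun s => (Lp.coeFn_compMeasurePreserving G (hT s)).trans
      ((hT s).quasiMeasurePreserving.ae_eq_comp hg.coeFn_toL1)
  refine lintegral_congr_ae ?_
  filter_upwards [hs s, hs 0] with x hx hx'
  rw [Pi.sub_apply, hx, hx', sub_zero]

theorem lintegral_translation_le {g : ℝ → E} (hg : AEStronglyMeasurable g) (s : ℝ) :
    ∫⁻ x, ‖g (x - s) - g x‖ₑ ≤ 2 * ∫⁻ x, ‖g x‖ₑ := by
  calc ∫⁻ x, ‖g (x - s) - g x‖ₑ ≤ ∫⁻ x, (‖g (x - s)‖ₑ + ‖g x‖ₑ) :=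
        lintegral_mono fun x => enorm_sub_le
    _ = (∫⁻ x, ‖g (x - s)‖ₑ) + ∫⁻ x, ‖g x‖ₑ := lintegral_add_right' _ hg.enorm
    _ = _ := by rw [lintegral_sub_right_eq_self (fun x => ‖g x‖ₑ) s, two_mul]

/-- Dominated convergence in `y`, the inner integral being at most `2‖g‖₁`. It serves twice, with
the roles of `f` and of the kernel exchanged: `δ → 0` at a finite frequency, and `δ = R⁻¹` at
infinity. -/
theorem tendsto_lintegral_mul_translation {u : ℝ → F} {g : ℝ → E} (hu : Integrable u)
    (hg : Integrable g) :
    Tendsto (fun δ : ℝ => ∫⁻ y, ‖u y‖ₑ * ∫⁻ x, ‖g (x - δ * y) - g x‖ₑ) (𝓝 0) (𝓝 0) := by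
  have h2 : (∫⁻ x, ‖g x‖ₑ) ≠ ⊤ := hg.2.ne
  have key := tendsto_lintegral_filter_of_dominated_convergence' (μ := volume) (l := 𝓝 (0 : ℝ))
    (F := fun δ y => ‖u y‖ₑ * ∫⁻ x, ‖g (x - δ * y) - g x‖ₑ) (f := fun _ => 0)
    (fun y => ‖u y‖ₑ * (2 * ∫⁻ x, ‖g x‖ₑ)) ?_ ?_ ?_ ?_
  · simpa using key
  · refine Eventually.of_forall fun δ => hu.1.enorm.mul ?_
    have hm : AEStronglyMeasurable (fun z : ℝ × ℝ => g (z.2 - δ * z.1) - g z.2)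
        (volume.prod volume) := by
      refine AEStronglyMeasurable.sub ?_ hg.1.comp_snd
      refine hg.1.comp_quasiMeasurePreserving ?_
      refine QuasiMeasurePreserving.prod_of_right
        (by fun_prop) (Eventually.of_forall fun y => ?_)
      exact (measurePreserving_sub_right (volume : Measure ℝ) (δ * y)).quasiMeasurePreserving
    exact hm.enorm.lintegral_prod_right'
  · exact Eventually.of_forall fun δ => Eventually.of_forall fun y => by
      gcongr
      exact lintegral_translation_le hg.1 _
  · rw [lintegral_mul_const'' _ hu.1.enorm]
    exact ENNReal.mul_ne_top hu.2.ne (ENNReal.mul_ne_top (by simp) h2)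
  · refine Eventually.of_forall fun y => ?_
    have h1 : Tendsto (fun δ : ℝ => δ * y) (𝓝 0) (𝓝 0) := by
      simpa using (tendsto_id (x := 𝓝 (0 : ℝ))).mul_const y
    simpa using ENNReal.Tendsto.const_mul ((tendsto_lintegral_translation hg).comp h1)
      (Or.inr enorm_ne_top)

end Translation

/-! ### Frequency-localising kernels and their `L¹` estimates. -/

section Kernels

open FourierTransform Topology
open scoped SchwartzMap

/-- A fixed smooth bump function on the line, equal to `1` on `[-1, 1]` and
supported in `[-2, 2]`. -/
def unitBump : ContDiffBump (0 : ℝ) := ⟨1, 2, one_pos, one_lt_two⟩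

/-- The bump function `unitBump`, transported to the interval with center `τ` and radius `δ`, as a
Schwartz function. -/
def bump (τ : ℝ) (δ : ℝ) (hδ : 0 < δ) : 𝓢(ℝ, ℂ) :=
  HasCompactSupport.toSchwartzMap (f := fun t => ((unitBump (δ⁻¹ * (t - τ)) : ℝ) : ℂ))
    (by
      have h : HasCompactSupport fun t : ℝ => unitBump (δ⁻¹ * (t - τ)) := by
        have := unitBump.hasCompactSupport.comp_homeomorph
          ((Homeomorph.subRight τ).trans (Homeomorph.mulLeft₀ δ⁻¹ (inv_ne_zero hδ.ne')))
        exact this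
      exact h.comp_left Complex.ofReal_zero)
    (Complex.ofRealCLM.contDiff.comp (unitBump.contDiff.comp (by fun_prop)))

theorem bump_apply {τ δ : ℝ} (hδ : 0 < δ) (t : ℝ) :
    bump τ δ hδ t = ((unitBump (δ⁻¹ * (t - τ)) : ℝ) : ℂ) := rfl

theorem bump_eq_one {τ δ : ℝ} (hδ : 0 < δ) {t : ℝ} (ht : |t - τ| ≤ δ) : bump τ δ hδ t = 1 := by
  rw [bump_apply, unitBump.one_of_mem_closedBall, Complex.ofReal_one]
  rw [mem_closedBall_zero_iff, Real.norm_eq_abs, abs_mul, abs_of_pos (inv_pos.2 hδ)]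
  exact (inv_mul_le_one₀ hδ).2 ht

theorem bump_eq_zero {τ δ : ℝ} (hδ : 0 < δ) {t : ℝ} (ht : 2 * δ ≤ |t - τ|) :
    bump τ δ hδ t = 0 := by
  rw [bump_apply, unitBump.zero_of_le_dist, Complex.ofReal_zero]
  rw [dist_zero_right, Real.norm_eq_abs, abs_mul, abs_of_pos (inv_pos.2 hδ)]
  change 2 ≤ _
  rwa [le_inv_mul_iff₀ hδ, mul_comm]

/-- Every kernel is a modulated dilate of a single one, which reduces the estimates to translations
of a fixed function. -/
theorem fourierInv_bump {τ δ : ℝ} (hδ : 0 < δ) (x : ℝ) :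
    𝓕⁻ (bump τ δ hδ) x =
      δ * Complex.exp (2 * Real.pi * τ * x * Complex.I) * 𝓕⁻ (bump 0 1 one_pos) (δ * x) := by
  rw [SchwartzMap.fourierInv_coe, SchwartzMap.fourierInv_coe, Real.fourierInv_eq',
    Real.fourierInv_eq', ← integral_add_right_eq_self _ τ]
  have h := Measure.integral_comp_mul_left (fun v : ℝ =>
    Complex.exp (↑(2 * Real.pi * inner ℝ (v + τ) x) * Complex.I) • bump τ δ hδ (v + τ)) δ
  rw [abs_of_pos (inv_pos.2 hδ)] at h
  have h' := congrArg (fun z => δ • z) h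
  simp only [smul_smul, mul_inv_cancel₀ hδ.ne', one_smul] at h'
  rw [← h', ← integral_smul, ← integral_const_mul]
  refine integral_congr_ae (Eventually.of_forall fun v => ?_)
  simp only [bump_apply, add_sub_cancel_right, inv_mul_cancel_left₀ hδ.ne', sub_zero, inv_one,
    one_mul, RCLike.inner_apply, conj_trivial, smul_eq_mul, Complex.real_smul]
  have : Complex.exp (↑(2 * Real.pi * (x * (δ * v + τ))) * Complex.I) =
      Complex.exp (2 * Real.pi * τ * x * Complex.I) *
        Complex.exp (↑(2 * Real.pi * (δ * x * v)) * Complex.I) := by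
    rw [← Complex.exp_add]
    congr 1
    push_cast
    ring
  rw [this]
  ring

theorem lintegral_comp_mul_left_of_pos (F : ℝ → ENNReal) {a : ℝ} (ha : 0 < a) :
    ENNReal.ofReal a * ∫⁻ x, F (a * x) = ∫⁻ x, F x := by
  conv_rhs => rw [← Real.smul_map_volume_mul_left ha.ne', lintegral_smul_measure,
    (measurableEmbedding_mulLeft₀ ha.ne').lintegral_map, abs_of_pos ha]
  rfl

theorem integral_fourierInv_bump {R : ℝ} (hR : 0 < R) : ∫ x, 𝓕⁻ (bump 0 R hR) x = 1 := by
  have h : 𝓕 (𝓕⁻ (bump 0 R hR)) 0 = 1 := by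
    rw [FourierTransform.fourier_fourierInv_eq]
    exact bump_eq_one hR (by simpa using hR.le)
  rw [SchwartzMap.fourier_coe, Real.fourier_eq'] at h
  simpa using h

variable {A : Type*} [NormedRing A] [NormedAlgebra ℂ A]

/-- The Fourier integral `∫ f(x) e^{itx} dx`. -/
def fourierInt (f : ℝ → A) (t : ℝ) : A := ∫ x : ℝ, Complex.exp (Complex.I * t * x) • f x

/-- The scalar kernel whose Fourier transform is the given Schwartz function, as an integrable
function. -/
theorem integrable_kernel (χ : 𝓢(ℝ, ℂ)) : Integrable (𝓕⁻ χ : 𝓢(ℝ, ℂ)) := SchwartzMap.integrable _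

theorem enorm_exp_I_mul (t y : ℝ) : ‖Complex.exp (Complex.I * t * y)‖ₑ = 1 := by
  rw [← ofReal_norm, show Complex.I * t * y = ((t * y : ℝ) : ℂ) * Complex.I by push_cast; ring,
    Complex.norm_exp_ofReal_mul_I, ENNReal.ofReal_one]

/-- With `W` the kernel, both terms are integrals of `f y`, against `W (x - y)` and `e^{-2πiτy} W
x`. The modulation of `W` makes the phases agree, so only a dilated difference of translates of the
fixed kernel remains, and rescaling `x` removes the dilation. The frequency `-2πτ` translates the
normalisation of `𝓕` into that of `symbol`. -/
theorem ofReal_norm_convL1_kernel_sub_le (f : L1 A) (τ : ℝ) {δ : ℝ} (hδ : 0 < δ) :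
    ENNReal.ofReal ‖convL1 f (scalarL1 (integrable_kernel (bump τ δ hδ)) 1) -
        scalarL1 (integrable_kernel (bump τ δ hδ)) (fourierInt f (-2 * Real.pi * τ))‖ ≤
      ∫⁻ y, ‖f y‖ₑ * ∫⁻ x, ‖(𝓕⁻ (bump 0 1 one_pos) : 𝓢(ℝ, ℂ)) (x - δ * y) -
        (𝓕⁻ (bump 0 1 one_pos) : 𝓢(ℝ, ℂ)) x‖ₑ := by
  set W : 𝓢(ℝ, ℂ) := 𝓕⁻ (bump τ δ hδ) with hW
  set V : 𝓢(ℝ, ℂ) := 𝓕⁻ (bump 0 1 one_pos) with hV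
  set e : ℝ → ℂ := fun y => Complex.exp (Complex.I * (-2 * Real.pi * τ : ℝ) * y) with he
  have hf := L1.integrable f
  have hWi : Integrable W := integrable_kernel _
  have hef : Integrable fun y => e y • f y := by
    refine hf.mono ?_ (Eventually.of_forall fun y => ?_)
    · exact AEStronglyMeasurable.smul (Continuous.aestronglyMeasurable (by fun_prop)) hf.1
    · rw [← toReal_enorm, ← toReal_enorm, enorm_smul, enorm_exp_I_mul, one_mul]
  rw [L1.ofReal_norm]
  have h1 : ∀ᵐ x, ‖(convL1 f (scalarL1 (integrable_kernel (bump τ δ hδ)) 1) -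
        scalarL1 (integrable_kernel (bump τ δ hδ)) (fourierInt f (-2 * Real.pi * τ))) x‖ₑ ≤
      ∫⁻ y, ‖f y‖ₑ * ‖W (x - y) - e y * W x‖ₑ := by
    filter_upwards [Lp.coeFn_sub (convL1 f (scalarL1 hWi 1))
      (scalarL1 hWi (fourierInt f (-2 * Real.pi * τ))), coeFn_convL1 f (scalarL1 hWi 1),
      coeFn_scalarL1 hWi (fourierInt f (-2 * Real.pi * τ)),
      hf.ae_convolution_exists (ContinuousLinearMap.mul ℂ A) (hWi.smul_const (1 : A))]
      with x h1 h2 h3 h4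
    have h4' : Integrable fun y => W (x - y) • f y := by
      refine h4.congr (Eventually.of_forall fun y => ?_)
      simp
    rw [h1, Pi.sub_apply, h2, h3, conv_congr (ae_eq_refl _) (coeFn_scalarL1 hWi 1), conv_apply]
    have h5 : ∫ y, f y * W (x - y) • (1 : A) = ∫ y, W (x - y) • f y := by simp
    have h6 : W x • fourierInt f (-2 * Real.pi * τ) = ∫ y, W x • e y • f y := by
      rw [integral_smul]
      rfl
    rw [h5, h6, ← integral_sub h4' (hef.fun_smul (W x))]
    refine (enorm_integral_le_lintegral_enorm _).trans (lintegral_mono fun y => ?_)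
    rw [smul_smul, ← sub_smul, enorm_smul, mul_comm, mul_comm (W x)]
  refine (lintegral_mono_ae h1).trans ?_
  rw [lintegral_lintegral_swap]
  · refine lintegral_mono fun y => ?_
    rw [lintegral_const_mul' _ _ enorm_ne_top]
    refine mul_le_mul_right ?_ _
    rw [← lintegral_comp_mul_left_of_pos (fun x => ‖V (x - δ * y) - V x‖ₑ) hδ,
      ← lintegral_const_mul' _ _ ENNReal.ofReal_ne_top]
    refine le_of_eq (lintegral_congr fun x => ?_)
    rw [hW, fourierInv_bump hδ, fourierInv_bump hδ, ← mul_sub]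
    have h7 : Complex.exp (2 * Real.pi * τ * (x - y : ℝ) * Complex.I) =
        e y * Complex.exp (2 * Real.pi * τ * x * Complex.I) := by
      rw [he, ← Complex.exp_add]
      congr 1
      push_cast
      ring
    rw [h7, ← hV, show (δ : ℂ) * (e y * Complex.exp (2 * Real.pi * τ * x * Complex.I)) *
      V (δ * (x - y)) - e y * (δ * Complex.exp (2 * Real.pi * τ * x * Complex.I) * V (δ * x)) =
      δ * (e y * (Complex.exp (Complex.I * (2 * Real.pi * τ : ℝ) * x) *
        (V (δ * x - δ * y) - V (δ * x)))) by
        rw [mul_sub δ x y, show 2 * (Real.pi : ℂ) * τ * x * Complex.I =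
          Complex.I * (2 * Real.pi * τ : ℝ) * x by push_cast; ring]
        ring]
    rw [enorm_mul, enorm_mul, enorm_mul, enorm_exp_I_mul, enorm_exp_I_mul, one_mul, one_mul,
      ← ofReal_norm, Complex.norm_real, Real.norm_of_nonneg hδ.le, mul_sub δ x y]
  · have hm : AEStronglyMeasurable (fun z : ℝ × ℝ => W (z.1 - z.2) - e z.2 * W z.1)
        (volume.prod volume) := Continuous.aestronglyMeasurable (by fun_prop)
    exact (hf.1.comp_snd (μ := volume)).enorm.mul hm.enorm

/-- The kernels have integral one, so they form an approximate identity as `R` grows, and the error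
is an average of translation differences of `f`. -/
theorem ofReal_norm_sub_convL1_kernel_le [CompleteSpace A] (f : L1 A) {R : ℝ} (hR : 0 < R) :
    ENNReal.ofReal ‖f - convL1 f (scalarL1 (integrable_kernel (bump 0 R hR)) 1)‖ ≤
      ∫⁻ y, ‖(𝓕⁻ (bump 0 1 one_pos) : 𝓢(ℝ, ℂ)) y‖ₑ * ∫⁻ x, ‖f (x - R⁻¹ * y) - f x‖ₑ := by
  set W : 𝓢(ℝ, ℂ) := 𝓕⁻ (bump 0 R hR) with hW
  set V : 𝓢(ℝ, ℂ) := 𝓕⁻ (bump 0 1 one_pos) with hV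
  have hf := L1.integrable f
  have hWi : Integrable W := integrable_kernel _
  have hWc : ∫ x, W x = 1 := integral_fourierInv_bump hR
  rw [L1.ofReal_norm, ← convL1_scalarL1_comm]
  have h1 : ∀ᵐ x, ‖(f - convL1 (scalarL1 hWi 1) f) x‖ₑ ≤
      ∫⁻ y, ‖W y‖ₑ * ‖f (x - y) - f x‖ₑ := by
    filter_upwards [Lp.coeFn_sub f (convL1 (scalarL1 hWi 1) f), coeFn_convL1 (scalarL1 hWi 1) f,
      (hWi.smul_const (1 : A)).ae_convolution_exists (ContinuousLinearMap.mul ℂ A) hf]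
      with x h1 h2 h4
    have h4' : Integrable fun y => W y • f (x - y) := by
      refine h4.congr (Eventually.of_forall fun y => ?_)
      simp
    rw [h1, Pi.sub_apply, h2, conv_congr (coeFn_scalarL1 hWi 1) (ae_eq_refl _), conv_apply]
    have h5 : ∫ y, W y • (1 : A) * f (x - y) = ∫ y, W y • f (x - y) := by simp
    have h6 : f x = ∫ y, W y • f x := by
      rw [integral_smul_const, hWc, one_smul]
    rw [h5, enorm_sub_rev]
    conv_lhs => rw [h6]
    rw [← integral_sub h4' (hWi.smul_const _)]
    refine (enorm_integral_le_lintegral_enorm _).trans (lintegral_mono fun y => ?_)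
    rw [← smul_sub, enorm_smul]
  refine (lintegral_mono_ae h1).trans ?_
  rw [lintegral_lintegral_swap]
  · rw [← lintegral_comp_mul_left_of_pos (fun y => ‖V y‖ₑ * _) hR,
      ← lintegral_const_mul' _ _ ENNReal.ofReal_ne_top]
    refine le_of_eq (lintegral_congr fun y => ?_)
    rw [lintegral_const_mul' _ _ enorm_ne_top, hW, fourierInv_bump, enorm_mul, enorm_mul,
      ← ofReal_norm, Complex.norm_real, Real.norm_of_nonneg hR.le, inv_mul_cancel_left₀ hR.ne']
    simp [hV, mul_assoc]
  · have hm : AEStronglyMeasurable (fun z : ℝ × ℝ => f (z.1 - z.2) - f z.1)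
        (volume.prod volume) := by
      refine AEStronglyMeasurable.sub ?_ hf.1.comp_fst
      exact hf.1.comp_quasiMeasurePreserving (quasiMeasurePreserving_sub volume volume)
    exact (Continuous.aestronglyMeasurable (by fun_prop)).enorm.mul hm.enorm

theorem exists_norm_convL1_kernel_sub_lt (f : L1 A) (τ : ℝ) {ε : ℝ} (hε : 0 < ε) :
    ∃ (δ : ℝ) (hδ : 0 < δ), ‖convL1 f (scalarL1 (integrable_kernel (bump τ δ hδ)) 1) -
        scalarL1 (integrable_kernel (bump τ δ hδ)) (fourierInt f (-2 * Real.pi * τ))‖ < ε := by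
  have h := (tendsto_lintegral_mul_translation (L1.integrable f)
    (integrable_kernel (bump 0 1 one_pos))).mono_left (nhdsWithin_le_nhds (s := Set.Ioi 0))
  have h' := (h.eventually_lt_const (ENNReal.ofReal_pos.2 hε)).and self_mem_nhdsWithin
  obtain ⟨δ, h1, h2⟩ := h'.exists
  refine ⟨δ, h2, ?_⟩
  rw [← ENNReal.ofReal_lt_ofReal_iff hε]
  exact (ofReal_norm_convL1_kernel_sub_le f τ h2).trans_lt h1

theorem exists_norm_sub_convL1_kernel_lt [CompleteSpace A] (f : L1 A) {ε : ℝ} (hε : 0 < ε) :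
    ∃ (R : ℝ) (hR : 0 < R),
      ‖f - convL1 f (scalarL1 (integrable_kernel (bump 0 R hR)) 1)‖ < ε := by
  have h := (tendsto_lintegral_mul_translation (integrable_kernel (bump 0 1 one_pos))
    (L1.integrable f)).comp tendsto_inv_atTop_zero
  have h' := (h.eventually_lt_const (ENNReal.ofReal_pos.2 hε)).and (eventually_gt_atTop 0)
  obtain ⟨R, h1, h2⟩ := h'.exists
  refine ⟨R, h2, ?_⟩
  rw [← ENNReal.ofReal_lt_ofReal_iff hε]
  exact (ofReal_norm_sub_convL1_kernel_le f h2).trans_lt h1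

end Kernels

/-! ### Wiener's lemma in `L¹(ℝ, A)` by localisation in frequency. -/

section Inversion

open FourierTransform Topology
open scoped SchwartzMap

variable {A : Type*} [NormedRing A] [NormedAlgebra ℂ A]

/-- The Fourier multiplier on `L¹(ℝ, A)` whose symbol is the given Schwartz function. -/
def fourierMul (A : Type*) [NormedRing A] [NormedAlgebra ℂ A] (χ : 𝓢(ℝ, ℂ)) : L1 A →L[ℂ] L1 A :=
  sconv (integrable_kernel χ)

/-- The pointwise product of two Schwartz functions. -/
def schwartzMul (χ ψ : 𝓢(ℝ, ℂ)) : 𝓢(ℝ, ℂ) :=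
  SchwartzMap.pairing (ContinuousLinearMap.mul ℂ ℂ) χ ψ

theorem schwartzMul_apply (χ ψ : 𝓢(ℝ, ℂ)) (t : ℝ) : schwartzMul χ ψ t = χ t * ψ t := rfl

theorem fourierMul_add (χ ψ : 𝓢(ℝ, ℂ)) :
    fourierMul A (χ + ψ) = fourierMul A χ + fourierMul A ψ := by
  ext1 h
  change convL1 h (scalarL1 _ 1) = convL1 h (scalarL1 _ 1) + convL1 h (scalarL1 _ 1)
  rw [← map_add]
  congr 1
  refine scalarL1_add _ _ _ (fun x => ?_) _
  rw [FourierTransform.fourierInv_add]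
  rfl

theorem fourierMul_sub (χ ψ : 𝓢(ℝ, ℂ)) :
    fourierMul A (χ - ψ) = fourierMul A χ - fourierMul A ψ := by
  rw [eq_sub_iff_add_eq, ← fourierMul_add, sub_add_cancel]

theorem fourierMul_zero : fourierMul A (0 : 𝓢(ℝ, ℂ)) = 0 := by
  simpa using fourierMul_sub (A := A) 0 0

variable [CompleteSpace A]

theorem fourierMul_mul (χ ψ : 𝓢(ℝ, ℂ)) :
    fourierMul A χ * fourierMul A ψ = fourierMul A (schwartzMul χ ψ) := by
  refine sconv_mul_sconv _ _ _ fun x => ?_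
  have h := SchwartzMap.convolution_apply (ContinuousLinearMap.mul ℂ ℂ) (𝓕⁻ ψ) (𝓕⁻ χ) x
  have h' : SchwartzMap.convolution (ContinuousLinearMap.mul ℂ ℂ) (𝓕⁻ ψ) (𝓕⁻ χ) =
      𝓕⁻ (schwartzMul χ ψ) := by
    have h1 : schwartzMul χ ψ = schwartzMul ψ χ := by
      ext t
      simp [schwartzMul_apply, mul_comm]
    rw [h1]
    simp [SchwartzMap.convolution, schwartzMul]
  rw [h'] at h
  rw [h]
  rfl

theorem fourierMul_mul_eq {χ ψ : 𝓢(ℝ, ℂ)} (h : ∀ t, χ t ≠ 0 → ψ t = 1) :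
    fourierMul A χ * fourierMul A ψ = fourierMul A χ := by
  rw [fourierMul_mul]
  congr 1
  ext t
  rw [schwartzMul_apply]
  by_cases ht : χ t = 0
  · simp [ht]
  · simp [h t ht]

theorem fourierMul_comm_rconv (χ : 𝓢(ℝ, ℂ)) (f : L1 A) :
    fourierMul A χ * rconv f = rconv f * fourierMul A χ := sconv_mul_rconv _ f

theorem exists_one_add_mul_eq_one {R : Type*} [NormedRing R] [CompleteSpace R] {K : R}
    (hK : ‖K‖ < 1) : ∃ U, (1 + K) * U = 1 := by
  have := (isUnit_one_sub_of_norm_lt_one (x := -K) (by rwa [norm_neg])).exists_right_inv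
  simpa using this

/-- Near a frequency where the symbol is left invertible, Fourier multipliers factor through
right convolution by `𝟏 + f`. -/
theorem exists_fourierMul_bump_eq (f : L1 A) (τ : ℝ)
    (h : ∃ c : A, c * symbol f (-2 * Real.pi * τ) = 1) :
    ∃ (δ : ℝ) (hδ : 0 < δ) (B : L1 A →L[ℂ] L1 A),
      fourierMul A (bump τ δ hδ) = (1 + rconv f) * B := by
  obtain ⟨c, hc⟩ := h
  set a := fourierInt f (-2 * Real.pi * τ) with ha
  replace hc : c * (1 + a) = 1 := hc
  obtain ⟨δ, hδ, hlt⟩ := exists_norm_convL1_kernel_sub_lt f τ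
    (ε := (‖rmul c‖ + 1)⁻¹) (by positivity)
  set S := fourierMul A (bump τ δ hδ) with hS
  -- Halving the radius puts the support of this bump where the symbol of `S` is one, so `P` absorbs
  -- `S`.
  set P := fourierMul A (bump τ (δ / 2) (half_pos hδ)) with hP
  -- The localised error of replacing `f` by the constant `a`, small by the choice of `δ`.
  set K := S * (rconv f - rmul a) * rmul c with hK
  have hK1 : ‖K‖ < 1 := by
    rw [hK, hS, fourierMul, sconv_mul_sub]
    have h1 := (norm_rconv_le (convL1 f (scalarL1 (integrable_kernel (bump τ δ hδ)) 1) -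
        scalarL1 (integrable_kernel (bump τ δ hδ)) a)).trans hlt.le
    refine (ContinuousLinearMap.opNorm_comp_le _ _).trans_lt ?_
    refine (mul_le_mul_of_nonneg_right h1 (norm_nonneg (rmul c))).trans_lt ?_
    rw [inv_mul_lt_iff₀ (by positivity)]
    linarith
  have hPS : P * S = P := fourierMul_mul_eq fun t ht => by
    refine bump_eq_one hδ ?_
    by_contra! hlt
    exact ht (bump_eq_zero _ (by linarith))
  obtain ⟨U, hU⟩ := exists_one_add_mul_eq_one (R := L1 A →L[ℂ] L1 A) hK1
  refine ⟨δ / 2, half_pos hδ, P * rmul c * U, ?_⟩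
  have h1 : (1 + rconv f) * P = P * (1 + rconv f) := by
    rw [mul_add, add_mul, mul_one, one_mul, hP, fourierMul_comm_rconv]
  -- Since `rmul` reverses products, a left inverse `c` of `1 + a` gives a right inverse of `1 +
  -- rmul a`.
  have h2 : (1 + rconv f) * rmul c = 1 + (rconv f - rmul a) * rmul c := by
    have : (1 + rmul a) * rmul c = 1 := by
      rw [← rmul_one, ← rmul_add, rmul_mul_rmul, hc]
    calc (1 + rconv f) * rmul c = (1 + rmul a) * rmul c + (rconv f - rmul a) * rmul c := by
          noncomm_ring
      _ = _ := by rw [this]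
  calc P = P * ((1 + K) * U) := by rw [hU, mul_one]
    _ = (P + P * S * (rconv f - rmul a) * rmul c) * U := by
      rw [hK]; noncomm_ring
    _ = P * (1 + (rconv f - rmul a) * rmul c) * U := by
      rw [hPS]; noncomm_ring
    _ = (1 + rconv f) * P * rmul c * U := by
      rw [← h2, h1]; noncomm_ring
    _ = _ := by noncomm_ring

/-- Induction over unions replaces a partition of unity: `χ + ψ - ψχ` is one wherever `χ` or `ψ` is,
and the left factor `1 + rconv f` survives because the extra multiplier enters on the right. -/
theorem exists_fourierMul_eq_of_isCompact (f : L1 A)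
    (h : ∀ t : ℝ, ∃ c : A, c * symbol f t = 1) {s : Set ℝ} (hs : IsCompact s) :
    ∃ (χ : 𝓢(ℝ, ℂ)) (B : L1 A →L[ℂ] L1 A), (∀ t ∈ s, χ t = 1) ∧
      fourierMul A χ = (1 + rconv f) * B := by
  refine hs.induction_on (p := fun s => ∃ (χ : 𝓢(ℝ, ℂ)) (B : L1 A →L[ℂ] L1 A),
    (∀ t ∈ s, χ t = 1) ∧ fourierMul A χ = (1 + rconv f) * B) ?_ ?_ ?_ ?_
  · exact ⟨0, 0, by simp, by simp [fourierMul_zero]⟩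
  · rintro s t hst ⟨χ, B, h1, h2⟩
    exact ⟨χ, B, fun t ht => h1 t (hst ht), h2⟩
  · rintro s t ⟨χ, B, h1, h2⟩ ⟨ψ, C, h3, h4⟩
    refine ⟨χ + (ψ - schwartzMul ψ χ), B + C - C * fourierMul A χ, ?_, ?_⟩
    · rintro t (ht | ht)
      · simp [schwartzMul_apply, h1 t ht]
      · simp [schwartzMul_apply, h3 t ht]
    · rw [fourierMul_add, fourierMul_sub, ← fourierMul_mul, h4, mul_sub, mul_add, ← h2]
      noncomm_ring
  · intro τ _
    obtain ⟨δ, hδ, B, hB⟩ := exists_fourierMul_bump_eq f τ (h _)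
    refine ⟨Metric.closedBall τ δ, nhdsWithin_le_nhds (Metric.closedBall_mem_nhds τ hδ),
      bump τ δ hδ, B, fun t ht => bump_eq_one hδ ?_, hB⟩
    rwa [Metric.mem_closedBall, Real.dist_eq] at ht

/-- Wiener's theorem in `L¹(ℝ, A)` for one-sided inverses. -/
theorem exists_leftInverse_L1 (f : L1 A) (h : ∀ t : ℝ, ∃ c : A, c * symbol f t = 1) :
    ∃ g : L1 A, g + f + convL1 g f = 0 := by
  obtain ⟨R, hR, hlt⟩ := exists_norm_sub_convL1_kernel_lt f one_pos
  -- Nested cut-offs: the symbol of `S` lives on `[-2R, 2R]`, that of `P` is one there and lives on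
  -- `[-4R, 4R]`, and `χ` is one on the latter. `K` is the small high-frequency remainder of `rconv
  -- f`.
  set S := fourierMul A (bump 0 R hR) with hS
  set P := fourierMul A (bump 0 (2 * R) (by positivity)) with hP
  set K := rconv (f - convL1 f (scalarL1 (integrable_kernel (bump 0 R hR)) 1)) with hK
  have hK' : K = rconv f - S * rconv f := by
    rw [hK, rconv_sub]
    congr 1
    ext1 k
    change convL1 k _ = convL1 (convL1 k f) _
    rw [convL1_assoc]
  obtain ⟨U, hU⟩ := exists_one_add_mul_eq_one (R := L1 A →L[ℂ] L1 A)
    ((norm_rconv_le _).trans_lt hlt : ‖K‖ < 1)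
  obtain ⟨χ, B, h1, h2⟩ := exists_fourierMul_eq_of_isCompact f h
    (isCompact_closedBall (0 : ℝ) (4 * R))
  have hSP : P * S = S := by
    rw [hP, fourierMul_mul, hS]
    congr 1
    ext t
    rw [schwartzMul_apply]
    by_cases ht : |t - 0| ≤ 2 * R
    · rw [bump_eq_one _ ht, one_mul]
    · rw [bump_eq_zero hR (not_le.1 ht).le, mul_zero]
  have hχP : fourierMul A χ * P = P := by
    rw [fourierMul_mul, hP]
    congr 1
    ext t
    rw [schwartzMul_apply]
    by_cases ht : |t - 0| ≤ 4 * R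
    · rw [h1 t (by rwa [Metric.mem_closedBall, Real.dist_eq]), one_mul]
    · rw [bump_eq_zero (δ := 2 * R) _ (by linarith), mul_zero]
  have hPf : P * rconv f = rconv f * P := fourierMul_comm_rconv _ f
  -- `B` inverts the low frequencies and `U` the high ones. As `1 - P` kills `S`, it turns `rconv f`
  -- into `K`.
  have key : (1 + rconv f) * (B * P + (1 - P) * U) = 1 := by
    have e1 : (1 + rconv f) * (1 - P) = (1 - P) * (1 + K) := by
      have : P * S * rconv f = S * rconv f := by rw [hSP]
      calc (1 + rconv f) * (1 - P) = 1 + rconv f - P - rconv f * P := by noncomm_ring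
        _ = 1 + rconv f - P - P * rconv f + (P * S * rconv f - S * rconv f) := by
          rw [this, hPf]; noncomm_ring
        _ = _ := by rw [hK']; noncomm_ring
    calc (1 + rconv f) * (B * P + (1 - P) * U) =
        ((1 + rconv f) * B) * P + ((1 + rconv f) * (1 - P)) * U := by noncomm_ring
      _ = P + (1 - P) * ((1 + K) * U) := by rw [← h2, hχP, e1]; noncomm_ring
      _ = 1 := by rw [hU]; noncomm_ring
  refine ⟨(B * P + (1 - P) * U) (-f), ?_⟩
  have := congrArg (fun T : L1 A →L[ℂ] L1 A => T (-f)) key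
  set g := (B * P + (1 - P) * U) (-f)
  replace this : g + convL1 g f = -f := this
  rw [add_right_comm, this, neg_add_cancel]

end Inversion

/-! ### Local bounds and exponential rates of weights; half-line weights. -/

section Weights

open Topology

variable {ω : ℝ → ℝ}

theorem IsWeight.pos (hω : IsWeight ω) (x : ℝ) : 0 < ω x := one_pos.trans_le (hω.one_le x)

theorem IsWeight.comp_neg (hω : IsWeight ω) : IsWeight fun x => ω (-x) where
  measurable := hω.measurable.comp measurable_neg
  one_le x := hω.one_le _
  map_add_le x y := by
    rw [neg_add]
    exact hω.map_add_le _ _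

theorem IsWeight.nat_mul_add_le (hω : IsWeight ω) (n : ℕ) (x s : ℝ) :
    ω (n * x + s) ≤ ω x ^ n * ω s := by
  induction n with
  | zero => simp
  | succ n ih =>
    calc ω ((n + 1 : ℕ) * x + s) = ω (x + (n * x + s)) := by
          congr 1
          push_cast
          ring
      _ ≤ ω x * ω (n * x + s) := hω.map_add_le _ _
      _ ≤ ω x * (ω x ^ n * ω s) := mul_le_mul_of_nonneg_left ih (hω.pos x).le
      _ = _ := by ring

/-- Weights are locally bounded. -/
theorem IsWeight.exists_bound (hω : IsWeight ω) (N : ℝ) : ∃ C, ∀ x, |x| ≤ N → ω x ≤ C := by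
  -- Steinhaus argument: some reflection-symmetric sublevel set has positive measure, so its
  -- difference set contains a neighbourhood of zero. Submultiplicativity bounds `ω` there, and then
  -- on any interval by dividing `x` into `k` short steps.
  let E : ℕ → Set ℝ := fun n => {x | ω x ≤ n ∧ ω (-x) ≤ n}
  have hE : ∀ n, MeasurableSet (E n) := fun n =>
    (measurableSet_le hω.measurable measurable_const).inter
      (measurableSet_le hω.comp_neg.measurable measurable_const)
  obtain ⟨n, hn⟩ : ∃ n, 0 < volume (E n) := by
    by_contra! h
    have h1 : volume (⋃ n, E n) = 0 := measure_iUnion_null fun n => le_antisymm (h n) bot_le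
    have h2 : ⋃ n, E n = Set.univ := by
      refine Set.eq_univ_of_forall fun x => ?_
      obtain ⟨n, hn⟩ := exists_nat_ge (max (ω x) (ω (-x)))
      exact Set.mem_iUnion.2 ⟨n, (le_max_left _ _).trans hn, (le_max_right _ _).trans hn⟩
    rw [h2] at h1
    simp at h1
  obtain ⟨r, hr, hball⟩ := Metric.mem_nhds_iff.1
    (Measure.sub_mem_nhds_zero_of_addHaar_pos volume (E n) (hE n) hn)
  have hloc : ∀ x, |x| < r → ω x ≤ (n : ℝ) * n := by
    intro x hx
    obtain ⟨a, ha, b, hb, rfl⟩ := hball (by simpa using hx : x ∈ Metric.ball (0 : ℝ) r)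
    change ω (a - b) ≤ _
    rw [sub_eq_add_neg]
    exact (hω.map_add_le _ _).trans (mul_le_mul ha.1 hb.2 (hω.pos _).le (by positivity))
  obtain ⟨k, hk⟩ := exists_nat_gt (N / r)
  refine ⟨((n : ℝ) * n) ^ k * ω 0, fun x hx => ?_⟩
  have hk0 : (0 : ℝ) < k := lt_of_le_of_lt (div_nonneg ((abs_nonneg x).trans hx) hr.le) hk
  have h1 : |x / k| < r := by
    rw [abs_div, abs_of_pos hk0, div_lt_iff₀ hk0]
    rw [div_lt_iff₀ hr] at hk
    linarith
  calc ω x = ω (k * (x / k) + 0) := by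
        congr 1
        field_simp
        ring
    _ ≤ ω (x / k) ^ k * ω 0 := hω.nat_mul_add_le k _ 0
    _ ≤ _ := mul_le_mul_of_nonneg_right
      (pow_le_pow_left₀ (hω.pos _).le (hloc _ h1) k) (hω.pos 0).le

theorem IsWeight.log_rpow_one_div (hω : IsWeight ω) (x : ℝ) :
    Real.log (ω x ^ (1 / x)) = 1 / x * Real.log (ω x) := Real.log_rpow (hω.pos x) _

/-- Reflecting the line exchanges the two rates, so only the right half-line needs to be treated. -/
theorem IsWeight.rho₁_eq (hω : IsWeight ω) : rho₁ ω = -rho₂ fun x => ω (-x) := by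
  rw [rho₁, rho₂, Real.sInf_def, neg_neg]
  congr 1
  ext a
  simp only [Set.mem_image, Set.mem_Iio, Set.mem_neg, Set.mem_Ioi]
  constructor
  · rintro ⟨x, hx, rfl⟩
    refine ⟨-x, by linarith, ?_⟩
    rw [neg_neg, hω.log_rpow_one_div, Real.log_rpow (hω.pos x)]
    ring
  · rintro ⟨x, hx, h⟩
    refine ⟨-x, by linarith, ?_⟩
    rw [Real.log_rpow (hω.pos _)] at h
    rw [hω.log_rpow_one_div, ← neg_eq_iff_eq_neg.2 h]
    ring

theorem IsWeight.rho₂_comp_neg (hω : IsWeight ω) : (rho₂ fun x => ω (-x)) = -rho₁ ω := by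
  rw [hω.rho₁_eq, neg_neg]

theorem IsWeight.rho₁_comp_neg (hω : IsWeight ω) : (rho₁ fun x => ω (-x)) = -rho₂ ω := by
  rw [hω.comp_neg.rho₁_eq]
  simp

theorem IsWeight.log_rpow_nonneg (hω : IsWeight ω) {x : ℝ} (hx : 0 < x) :
    0 ≤ Real.log (ω x ^ (1 / x)) := by
  rw [hω.log_rpow_one_div]
  exact mul_nonneg (by positivity) (Real.log_nonneg (hω.one_le x))

theorem IsWeight.rho₂_nonneg (hω : IsWeight ω) : 0 ≤ rho₂ ω := by
  refine Real.sInf_nonneg ?_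
  rintro _ ⟨x, hx, rfl⟩
  exact hω.log_rpow_nonneg hx

/-- A weight with `ρ₂ = 0` has subexponential growth on the right. -/
theorem IsWeight.exists_le_exp (hω : IsWeight ω) (h : rho₂ ω = 0) {δ : ℝ} (hδ : 0 < δ) :
    ∃ C, ∀ x ≥ 0, ω x ≤ C * Real.exp (δ * x) := by
  obtain ⟨_, ⟨x₀, hx₀, rfl⟩, hlt⟩ := exists_lt_of_csInf_lt (Set.nonempty_Ioi.image _)
    (show rho₂ ω < δ by rwa [h])
  simp only [Set.mem_Ioi] at hx₀
  have h0 : ω x₀ ≤ Real.exp (δ * x₀) := by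
    beta_reduce at hlt
    rw [hω.log_rpow_one_div, one_div, inv_mul_lt_iff₀ hx₀] at hlt
    rw [← Real.log_le_iff_le_exp (hω.pos _), mul_comm]
    exact hlt.le
  obtain ⟨C, hC⟩ := hω.exists_bound x₀
  refine ⟨C, fun x hx => ?_⟩
  set n := ⌊x / x₀⌋₊
  have hn1 : (n : ℝ) * x₀ ≤ x := (le_div_iff₀ hx₀).1 (Nat.floor_le (by positivity))
  have hn2 : x < (n + 1) * x₀ := (div_lt_iff₀ hx₀).1 (Nat.lt_floor_add_one _)
  have hs : ω (x - n * x₀) ≤ C := hC _ (by rw [abs_of_nonneg] <;> linarith)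
  calc ω x = ω (n * x₀ + (x - n * x₀)) := by ring_nf
    _ ≤ ω x₀ ^ n * ω (x - n * x₀) := hω.nat_mul_add_le n _ _
    _ ≤ Real.exp (δ * x₀) ^ n * C :=
      mul_le_mul (pow_le_pow_left₀ (hω.pos _).le h0 n) hs (hω.pos _).le (by positivity)
    _ = C * Real.exp (δ * (n * x₀)) := by rw [← Real.exp_nat_mul, mul_comm]; ring_nf
    _ ≤ C * Real.exp (δ * x) := by
      refine mul_le_mul_of_nonneg_left (Real.exp_le_exp.2 ?_) ((hω.pos _).le.trans hs)
      exact mul_le_mul_of_nonneg_left hn1 hδ.le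

theorem IsWeight.exp_rho₂_mul_le (hω : IsWeight ω) {x : ℝ} (hx : 0 ≤ x) :
    Real.exp (rho₂ ω * x) ≤ ω x := by
  rcases hx.eq_or_lt with rfl | hx
  · simpa using hω.one_le 0
  have h : rho₂ ω ≤ Real.log (ω x ^ (1 / x)) := by
    refine csInf_le ⟨0, ?_⟩ ⟨x, hx, rfl⟩
    rintro _ ⟨y, hy, rfl⟩
    exact hω.log_rpow_nonneg hy
  rw [hω.log_rpow_one_div, one_div, le_inv_mul_iff₀ hx] at h
  rw [← Real.le_log_iff_exp_le (hω.pos x), mul_comm]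
  exact h

theorem IsAlmostMonotoneAlgebraWeight.comp_neg {q : ℝ}
    (hω : IsAlmostMonotoneAlgebraWeight q ω) :
    IsAlmostMonotoneAlgebraWeight q fun x => ω (-x) where
  toIsWeight := hω.toIsWeight.comp_neg
  conv_le x := by
    refine le_trans (le_of_eq ?_) (hω.conv_le (-x))
    rw [← lintegral_neg_eq_self]
    refine lintegral_congr fun y => ?_
    rw [neg_neg, show -(x - -y) = -x - y by ring]
  lintegral_lt_top := by
    rw [lintegral_neg_eq_self fun x => ENNReal.ofReal (ω x ^ (-q))]
    exact hω.lintegral_lt_top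
  almost_monotone_neg h := by
    rw [hω.toIsWeight.rho₁_comp_neg, neg_eq_zero] at h
    obtain ⟨K, hK, hle⟩ := hω.almost_monotone_pos h
    refine ⟨K, hK, fun x hx y hy => ?_⟩
    rw [neg_add]
    exact hle _ (by linarith) _ (by linarith)
  almost_monotone_pos h := by
    rw [hω.toIsWeight.rho₂_comp_neg, neg_eq_zero] at h
    obtain ⟨K, hK, hle⟩ := hω.almost_monotone_neg h
    refine ⟨K, hK, fun x hx y hy => ?_⟩
    rw [neg_add]
    exact hle _ (by linarith) _ (by linarith)

/-- The properties of an almost monotone algebra weight on the half-line `[0, ∞)`, up to a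
constant `K`. -/
structure IsHalfLineWeight (q K : ℝ) (u : ℝ → ℝ) : Prop where
  measurable : Measurable u
  one_le : ∀ x, 1 ≤ u x
  map_add_le : ∀ x ≥ 0, ∀ y ≥ 0, u (x + y) ≤ u x * u y
  almost_monotone : ∀ x ≥ 0, ∀ y ≥ 0, u x ≤ K * u (x + y)
  conv_le : ∀ x ≥ 0, ∫⁻ y in Set.Ioo 0 x, ENNReal.ofReal (u y ^ (-q)) *
    ENNReal.ofReal (u (x - y) ^ (-q)) ≤ ENNReal.ofReal K * ENNReal.ofReal (u x ^ (-q))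
  lintegral_le : ∫⁻ x in Set.Ioi 0, ENNReal.ofReal (u x ^ (-q)) ≤ ENNReal.ofReal K

variable {q K : ℝ} {u v : ℝ → ℝ}

theorem IsHalfLineWeight.pos (hu : IsHalfLineWeight q K u) (x : ℝ) : 0 < u x :=
  one_pos.trans_le (hu.one_le x)

theorem IsHalfLineWeight.one_le_const (hu : IsHalfLineWeight q K u) : 1 ≤ K := by
  have h := hu.almost_monotone 0 le_rfl 0 le_rfl
  rw [add_zero] at h
  exact (le_mul_iff_one_le_left (hu.pos 0)).1 h

theorem IsHalfLineWeight.mono (hu : IsHalfLineWeight q K u) {K' : ℝ} (hK : K ≤ K') :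
    IsHalfLineWeight q K' u where
  measurable := hu.measurable
  one_le := hu.one_le
  map_add_le := hu.map_add_le
  almost_monotone x hx y hy := (hu.almost_monotone x hx y hy).trans
    (mul_le_mul_of_nonneg_right hK (hu.pos _).le)
  conv_le x hx := (hu.conv_le x hx).trans (mul_le_mul_left (ENNReal.ofReal_le_ofReal hK) _)
  lintegral_le := hu.lintegral_le.trans (ENNReal.ofReal_le_ofReal hK)

theorem IsAlmostMonotoneAlgebraWeight.exists_isHalfLineWeight
    (hω : IsAlmostMonotoneAlgebraWeight q ω) (h : rho₂ ω = 0) :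
    ∃ K, IsHalfLineWeight q K ω := by
  obtain ⟨K, hK, hle⟩ := hω.almost_monotone_pos h
  obtain ⟨B, hB⟩ : ∃ B : ℝ, ∫⁻ x, ENNReal.ofReal (ω x ^ (-q)) = ENNReal.ofReal B :=
    ⟨_, (ENNReal.ofReal_toReal hω.lintegral_lt_top.ne).symm⟩
  refine ⟨max 1 (max K B), hω.measurable, hω.one_le, fun x _ y _ => hω.map_add_le x y,
    fun x hx y hy => (hle x hx y hy).trans (mul_le_mul_of_nonneg_right
      ((le_max_left K B).trans (le_max_right _ _)) (hω.toIsWeight.pos _).le), fun x _ => ?_, ?_⟩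
  · refine (setLIntegral_le_lintegral _ _).trans ((hω.conv_le x).trans ?_)
    refine le_mul_of_one_le_left bot_le ?_
    rw [ENNReal.one_le_ofReal]
    exact le_max_left _ _
  · refine (setLIntegral_le_lintegral _ _).trans (hB.le.trans (ENNReal.ofReal_le_ofReal ?_))
    exact (le_max_right K B).trans (le_max_right _ _)

end Weights

/-! ### Gluing two half-line weights into an algebra weight. -/

section Glue

variable {q K : ℝ} {u v : ℝ → ℝ}

theorem ofReal_rpow_neg_le {q K s t : ℝ} (hq : 0 ≤ q) (hK : 0 ≤ K) (hs : 0 < s) (ht : 0 < t)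
    (h : s ≤ K * t) :
    ENNReal.ofReal (t ^ (-q)) ≤ ENNReal.ofReal (K ^ q) * ENNReal.ofReal (s ^ (-q)) := by
  rw [← ENNReal.ofReal_mul (by positivity)]
  refine ENNReal.ofReal_le_ofReal ?_
  rw [Real.rpow_neg ht.le, Real.rpow_neg hs.le, ← div_eq_mul_inv, inv_le_iff_one_le_mul₀
    (by positivity), div_mul_eq_mul_div, ← Real.mul_rpow hK ht.le, le_div_iff₀ (by positivity),
    one_mul]
  exact Real.rpow_le_rpow hs.le h hq

/-- The function on `ℝ` given by `u` on `[0, ∞)` and by the reflection of `v` on `(-∞, 0)`. -/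
def glue (u v : ℝ → ℝ) (x : ℝ) : ℝ := if 0 ≤ x then u x else v (-x)

theorem glue_of_nonneg {x : ℝ} (hx : 0 ≤ x) : glue u v x = u x := if_pos hx

theorem glue_of_neg {x : ℝ} (hx : x < 0) : glue u v x = v (-x) := if_neg (not_le.2 hx)

theorem one_le_glue (hu : IsHalfLineWeight q K u) (hv : IsHalfLineWeight q K v) (x : ℝ) :
    1 ≤ glue u v x := by
  unfold glue
  split_ifs
  exacts [hu.one_le _, hv.one_le _]

theorem measurable_glue (hu : IsHalfLineWeight q K u) (hv : IsHalfLineWeight q K v) :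
    Measurable (glue u v) :=
  Measurable.ite measurableSet_Ici hu.measurable (hv.measurable.comp measurable_neg)

/-- For opposite signs, `x + y` lies between zero and the summand on its own side; almost
monotonicity bounds the value by `K` times the weight at that summand, and the other factor is at
least one. -/
theorem glue_add_le (hu : IsHalfLineWeight q K u) (hv : IsHalfLineWeight q K v) (x y : ℝ) :
    glue u v (x + y) ≤ K * (glue u v x * glue u v y) := by
  wlog hxy : y ≤ x generalizing x y
  · rw [add_comm, mul_comm (glue u v x)]
    exact this y x (not_le.1 hxy).le
  have hK := hu.one_le_const
  have hgx := one_le_glue hu hv x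
  have hgy := one_le_glue hu hv y
  rcases le_or_gt 0 y with hy | hy
  · have hx : 0 ≤ x := hy.trans hxy
    rw [glue_of_nonneg hx, glue_of_nonneg hy, glue_of_nonneg (add_nonneg hx hy)]
    refine (hu.map_add_le x hx y hy).trans ?_
    exact le_mul_of_one_le_left (mul_nonneg (hu.pos _).le (hu.pos _).le) hK
  rcases lt_or_ge x 0 with hx | hx
  · rw [glue_of_neg hx, glue_of_neg hy, glue_of_neg (add_neg hx hy), neg_add]
    refine (hv.map_add_le _ (by linarith) _ (by linarith)).trans ?_
    exact le_mul_of_one_le_left (mul_nonneg (hv.pos _).le (hv.pos _).le) hK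
  rcases le_or_gt 0 (x + y) with h | h
  · have h1 := hu.almost_monotone (x + y) h (-y) (by linarith)
    rw [add_neg_cancel_right] at h1
    rw [glue_of_nonneg h]
    rw [glue_of_nonneg hx] at hgx ⊢
    refine h1.trans (mul_le_mul_of_nonneg_left ?_ (by linarith))
    exact le_mul_of_one_le_right (hu.pos x).le hgy
  · have h1 := hv.almost_monotone (-(x + y)) (by linarith) x hx
    rw [show -(x + y) + x = -y by ring] at h1
    rw [glue_of_neg h]
    rw [glue_of_neg hy] at hgy ⊢
    refine h1.trans (mul_le_mul_of_nonneg_left ?_ (by linarith))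
    exact le_mul_of_one_le_left (hv.pos _).le hgx

theorem lintegral_glue_le (hu : IsHalfLineWeight q K u) (hv : IsHalfLineWeight q K v) :
    ∫⁻ x, ENNReal.ofReal (glue u v x ^ (-q)) ≤ 2 * ENNReal.ofReal K := by
  have h0 : (Set.Ici (0 : ℝ))ᶜ = Set.Iio 0 := Set.compl_Ici
  rw [← lintegral_add_compl _ (measurableSet_Ici (a := (0 : ℝ))), h0, two_mul]
  refine add_le_add ?_ ?_
  · rw [setLIntegral_congr Ioi_ae_eq_Ici.symm]
    refine le_trans (le_of_eq ?_) hu.lintegral_le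
    exact setLIntegral_congr_fun measurableSet_Ioi fun x hx => by
      rw [glue_of_nonneg (Set.mem_Ioi.1 hx).le]
  · refine le_trans (le_of_eq ?_) hv.lintegral_le
    rw [← lintegral_indicator measurableSet_Iio, ← lintegral_indicator measurableSet_Ioi,
      ← lintegral_neg_eq_self]
    refine lintegral_congr fun x => ?_
    by_cases hx : 0 < x
    · rw [Set.indicator_of_mem (Set.mem_Iio.2 (neg_neg_of_pos hx)),
        Set.indicator_of_mem (Set.mem_Ioi.2 hx), glue_of_neg (neg_neg_of_pos hx), neg_neg]
    · rw [Set.indicator_of_notMem (by simpa using hx), Set.indicator_of_notMem (by simpa using hx)]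

/-- For `y` strictly between `0` and `x` the half-line inequality applies. Otherwise `y` or `x - y`
lies at or beyond `x` on the same side, so almost monotonicity bounds its factor by `K ^ q` times
the value at `x`. The other factor has integral at most `2K`; adding both possibilities gives `4K`.
-/
theorem lintegral_glue_conv_le (hq : 0 ≤ q) (hu : IsHalfLineWeight q K u)
    (hv : IsHalfLineWeight q K v) (x : ℝ) :
    ∫⁻ y, ENNReal.ofReal (glue u v y ^ (-q)) * ENNReal.ofReal (glue u v (x - y) ^ (-q)) ≤
      ENNReal.ofReal (K + 4 * K ^ q * K) * ENNReal.ofReal (glue u v x ^ (-q)) := by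
  set a : ℝ → ENNReal := fun y => ENNReal.ofReal (glue u v y ^ (-q)) with ha
  have hK := hu.one_le_const
  have hK0 : 0 ≤ K := zero_le_one.trans hK
  have ham : Measurable a := ((measurable_glue hu hv).pow_const _).ennreal_ofReal
  obtain ⟨F, hF, hFle⟩ : ∃ F : ℝ → ENNReal, ∫⁻ y, F y ≤ ENNReal.ofReal K * a x ∧
      ∀ y, a y * a (x - y) ≤
        F y + ENNReal.ofReal (K ^ q) * a x * (a y + a (x - y)) := by
    rcases le_or_gt 0 x with hx | hx
    · refine ⟨(Set.Ioo 0 x).indicator fun y => ENNReal.ofReal (u y ^ (-q)) *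
        ENNReal.ofReal (u (x - y) ^ (-q)), ?_, fun y => ?_⟩
      · rw [lintegral_indicator measurableSet_Ioo]
        simpa only [ha, glue_of_nonneg hx] using hu.conv_le x hx
      · by_cases hy : y ∈ Set.Ioo 0 x
        · rw [Set.indicator_of_mem hy]
          simp only [ha]
          rw [glue_of_nonneg hy.1.le, glue_of_nonneg (sub_nonneg.2 hy.2.le)]
          exact le_self_add
        · rw [Set.indicator_of_notMem hy, zero_add]
          rcases le_or_gt y 0 with hy0 | hy0
          · have h1 : a (x - y) ≤ ENNReal.ofReal (K ^ q) * a x := by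
              simp only [ha]
              rw [glue_of_nonneg hx, glue_of_nonneg (by linarith : 0 ≤ x - y)]
              refine ofReal_rpow_neg_le hq hK0 (hu.pos _) (hu.pos _) ?_
              exact hu.almost_monotone x hx (-y) (by linarith)
            rw [mul_comm]
            exact mul_le_mul' h1 le_self_add
          · have hxy : x ≤ y := by
              by_contra! h
              exact hy ⟨hy0, h⟩
            have h1 : a y ≤ ENNReal.ofReal (K ^ q) * a x := by
              simp only [ha]
              rw [glue_of_nonneg hx, glue_of_nonneg hy0.le]
              refine ofReal_rpow_neg_le hq hK0 (hu.pos _) (hu.pos _) ?_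
              simpa using hu.almost_monotone x hx (y - x) (by linarith)
            exact mul_le_mul' h1 le_add_self
    · refine ⟨(Set.Ioo x 0).indicator fun y => ENNReal.ofReal (v (-y) ^ (-q)) *
        ENNReal.ofReal (v (-x - -y) ^ (-q)), ?_, fun y => ?_⟩
      · rw [← lintegral_neg_eq_self]
        have h1 := hv.conv_le (-x) (by linarith)
        rw [← lintegral_indicator measurableSet_Ioo] at h1
        simp only [ha, glue_of_neg hx]
        refine le_trans (le_of_eq (lintegral_congr fun y => ?_)) h1
        by_cases hy : y ∈ Set.Ioo 0 (-x)
        · rw [Set.indicator_of_mem hy, Set.indicator_of_mem (show -y ∈ Set.Ioo x 0 from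
            ⟨by linarith [hy.2], by linarith [hy.1]⟩), neg_neg]
        · rw [Set.indicator_of_notMem hy, Set.indicator_of_notMem]
          exact fun h => hy ⟨by linarith [h.2], by linarith [h.1]⟩
      · by_cases hy : y ∈ Set.Ioo x 0
        · rw [Set.indicator_of_mem hy]
          simp only [ha]
          rw [glue_of_neg hy.2, glue_of_neg (sub_neg.2 hy.1),
            show -(x - y) = -x - -y by ring]
          exact le_self_add
        · rw [Set.indicator_of_notMem hy, zero_add]
          rcases le_or_gt 0 y with hy0 | hy0
          · have h1 : a (x - y) ≤ ENNReal.ofReal (K ^ q) * a x := by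
              simp only [ha]
              rw [glue_of_neg hx, glue_of_neg (by linarith : x - y < 0)]
              refine ofReal_rpow_neg_le hq hK0 (hv.pos _) (hv.pos _) ?_
              have := hv.almost_monotone (-x) (by linarith) y hy0
              rwa [show -x + y = -(x - y) by ring] at this
            rw [mul_comm]
            exact mul_le_mul' h1 le_self_add
          · have hxy : y ≤ x := by
              by_contra! h
              exact hy ⟨h, hy0⟩
            have h1 : a y ≤ ENNReal.ofReal (K ^ q) * a x := by
              simp only [ha]
              rw [glue_of_neg hx, glue_of_neg hy0]
              refine ofReal_rpow_neg_le hq hK0 (hv.pos _) (hv.pos _) ?_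
              have := hv.almost_monotone (-x) (by linarith) (x - y) (by linarith)
              rwa [show -x + (x - y) = -y by ring] at this
            exact mul_le_mul' h1 le_add_self
  have hI : ∫⁻ y, (a y + a (x - y)) ≤ 4 * ENNReal.ofReal K := by
    rw [lintegral_add_left ham, lintegral_sub_left_eq_self a x]
    refine (add_le_add (lintegral_glue_le hu hv) (lintegral_glue_le hu hv)).trans (le_of_eq ?_)
    ring
  calc ∫⁻ y, a y * a (x - y)
      ≤ ∫⁻ y, (F y + ENNReal.ofReal (K ^ q) * a x * (a y + a (x - y))) := lintegral_mono hFle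
    _ = (∫⁻ y, F y) + ∫⁻ y, ENNReal.ofReal (K ^ q) * a x * (a y + a (x - y)) :=
      lintegral_add_right _ ((ham.add (ham.comp (measurable_const.sub measurable_id))).const_mul _)
    _ ≤ ENNReal.ofReal K * a x + ENNReal.ofReal (K ^ q) * a x * (4 * ENNReal.ofReal K) := by
      rw [lintegral_const_mul' _ _ (by finiteness)]
      exact add_le_add hF (mul_le_mul_right hI _)
    _ = _ := by
      rw [ENNReal.ofReal_add hK0 (by positivity), ENNReal.ofReal_mul (by positivity),
        ENNReal.ofReal_mul (by positivity), ENNReal.ofReal_ofNat]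
      ring

/-- Two half-line weights glue to an almost monotone algebra weight, after multiplication by a
large constant. -/
theorem isAlmostMonotoneAlgebraWeight_glue (hq : 1 ≤ q) (hu : IsHalfLineWeight q K u)
    (hv : IsHalfLineWeight q K v) {C : ℝ} (hC : K + 4 * K ^ q * K ≤ C) :
    IsAlmostMonotoneAlgebraWeight q fun x => C * glue u v x := by
  have hK := hu.one_le_const
  have hK0 : 0 ≤ K := zero_le_one.trans hK
  have hKC : K ≤ C := le_trans (le_add_of_nonneg_right (by positivity)) hC
  have hC1 : 1 ≤ C := hK.trans hKC
  have hC0 : 0 < C := one_pos.trans_le hC1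
  have hg := one_le_glue hu hv
  have hg0 : ∀ x, 0 < glue u v x := fun x => one_pos.trans_le (hg x)
  have hpow : ∀ x, ENNReal.ofReal ((C * glue u v x) ^ (-q)) =
      ENNReal.ofReal (C ^ (-q)) * ENNReal.ofReal (glue u v x ^ (-q)) := fun x => by
    rw [Real.mul_rpow hC0.le (hg0 x).le, ENNReal.ofReal_mul (by positivity)]
  refine ⟨⟨(measurable_glue hu hv).const_mul C, fun x => ?_, fun x y => ?_⟩, fun x => ?_, ?_,
    fun _ => ⟨K * u 0, mul_pos (by linarith) (hu.pos 0), fun x hx y hy => ?_⟩,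
    fun _ => ⟨K, by linarith, fun x hx y hy => ?_⟩⟩
  · nlinarith [hg x]
  · calc C * glue u v (x + y) ≤ C * (K * (glue u v x * glue u v y)) :=
        mul_le_mul_of_nonneg_left (glue_add_le hu hv x y) hC0.le
      _ ≤ C * (C * (glue u v x * glue u v y)) := by
        have := mul_pos (hg0 x) (hg0 y)
        gcongr
      _ = _ := by ring
  · simp_rw [hpow]
    calc ∫⁻ y, ENNReal.ofReal (C ^ (-q)) * ENNReal.ofReal (glue u v y ^ (-q)) *
          (ENNReal.ofReal (C ^ (-q)) * ENNReal.ofReal (glue u v (x - y) ^ (-q)))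
        = ENNReal.ofReal (C ^ (-q)) * ENNReal.ofReal (C ^ (-q)) *
          ∫⁻ y, ENNReal.ofReal (glue u v y ^ (-q)) *
            ENNReal.ofReal (glue u v (x - y) ^ (-q)) := by
          rw [← lintegral_const_mul' _ _ (by finiteness)]
          refine lintegral_congr fun y => ?_
          ring
      _ ≤ ENNReal.ofReal (C ^ (-q)) * ENNReal.ofReal (C ^ (-q)) *
          (ENNReal.ofReal (K + 4 * K ^ q * K) * ENNReal.ofReal (glue u v x ^ (-q))) :=
        mul_le_mul_right (lintegral_glue_conv_le (by linarith) hu hv x) _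
      _ = ENNReal.ofReal (C ^ (-q) * (K + 4 * K ^ q * K)) *
          (ENNReal.ofReal (C ^ (-q)) * ENNReal.ofReal (glue u v x ^ (-q))) := by
        rw [ENNReal.ofReal_mul (by positivity)]
        ring
      _ ≤ 1 * (ENNReal.ofReal (C ^ (-q)) * ENNReal.ofReal (glue u v x ^ (-q))) := by
        refine mul_le_mul_left ?_ _
        -- Scaling by `C` multiplies the convolution by `C^{-2q}` and the bound only by `C^{-q}`.
        -- The spare `C^{-q}` absorbs the constant, as `C ≤ C ^ q`.
        rw [ENNReal.ofReal_le_one, Real.rpow_neg hC0.le, inv_mul_le_one₀ (by positivity)]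
        refine hC.trans ?_
        simpa using Real.rpow_le_rpow_of_exponent_le hC1 hq
      _ = _ := one_mul _
  · simp_rw [hpow]
    rw [lintegral_const_mul' _ _ (by finiteness)]
    refine ENNReal.mul_lt_top (by finiteness) ((lintegral_glue_le hu hv).trans_lt (by finiteness))
  -- At zero the glued function takes the value `u 0`, which `v` does not control; hence the factor
  -- `u 0`.
  · have key : glue u v x ≤ K * u 0 * glue u v (x + y) := by
      have hu0 := hu.one_le 0
      rcases hx.eq_or_lt with rfl | hx
      · rw [glue_of_nonneg le_rfl]
        have := hg (0 + y)
        nlinarith [mul_pos (hu.pos 0) (hg0 (0 + y)), hu.pos 0]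
      · have h1 := hv.almost_monotone (-x) (by linarith) (-y) (by linarith)
        rw [← neg_add, ← glue_of_neg (u := u) (v := v) hx,
          ← glue_of_neg (u := u) (v := v) (by linarith)] at h1
        refine h1.trans ?_
        rw [mul_assoc]
        refine mul_le_mul_of_nonneg_left ?_ hK0
        exact le_mul_of_one_le_left (hg0 _).le hu0
    nlinarith
  · have h1 := hu.almost_monotone x hx y hy
    rw [← glue_of_nonneg (u := u) (v := v) hx,
      ← glue_of_nonneg (u := u) (v := v) (add_nonneg hx hy)] at h1
    nlinarith

end Glue

/-! ### Dominated weights of small exponential growth. -/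

section SmallWeights

variable {q : ℝ} {ω : ℝ → ℝ}

/-- The weight `e^{ε|x|} (1 + |x|)²`. -/
def expWeight (ε x : ℝ) : ℝ := Real.exp (ε * |x|) * (1 + |x|) ^ 2

theorem one_le_one_add_abs_sq (x : ℝ) : 1 ≤ (1 + |x|) ^ 2 := by
  nlinarith [abs_nonneg x]

theorem sq_le_expWeight {ε : ℝ} (hε : 0 ≤ ε) (x : ℝ) : (1 + |x|) ^ 2 ≤ expWeight ε x :=
  le_mul_of_one_le_left (by positivity) (Real.one_le_exp (by positivity))

/-- The exponential is multiplicative on `[0, ∞)`, so only `1 + y ≤ 2(1 + x)` matters. The leftover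
square yields an integrable factor free of `ε`. -/
theorem expWeight_le_four_mul {ε x y : ℝ} (hx : 0 ≤ x) (hxy : x ≤ y) (h : y ≤ 2 * x) :
    expWeight ε y * (1 + |y - x|) ^ 2 ≤ 4 * (expWeight ε x * expWeight ε (y - x)) := by
  have h1 : 0 ≤ y - x := by linarith
  have h2 : 0 ≤ y := by linarith
  unfold expWeight
  rw [abs_of_nonneg hx, abs_of_nonneg h1, abs_of_nonneg h2]
  have h3 : Real.exp (ε * y) = Real.exp (ε * x) * Real.exp (ε * (y - x)) := by
    rw [← Real.exp_add]
    ring_nf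
  rw [h3]
  have h4 : (1 + y) ^ 2 ≤ 4 * (1 + x) ^ 2 := by nlinarith
  have h5 : 0 ≤ Real.exp (ε * x) * Real.exp (ε * (y - x)) * (1 + (y - x)) ^ 2 := by positivity
  nlinarith [mul_le_mul_of_nonneg_left h4 h5]

/-- The weights `e^{ε|x|} (1 + |x|)²` are half-line weights with a constant that does not depend
on `ε`. -/
theorem exists_isHalfLineWeight_expWeight (hq : 1 ≤ q) :
    ∃ K, ∀ ε ≥ 0, IsHalfLineWeight q K (expWeight ε) := by
  set b : ℝ → ENNReal := fun x => ENNReal.ofReal (((1 + |x|) ^ 2) ^ (-q)) with hb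
  have hbm : Measurable b := by fun_prop
  have hbI : ∫⁻ x, b x < ⊤ := by
    have hi : Integrable fun x : ℝ => (1 + ‖x‖) ^ (-(2 : ℝ)) :=
      integrable_one_add_norm (by simp)
    refine lt_of_le_of_lt (lintegral_mono fun x => ?_) hi.lintegral_lt_top
    refine ENNReal.ofReal_le_ofReal ?_
    have h1 : 1 ≤ 1 + |x| := by linarith [abs_nonneg x]
    rw [← Real.rpow_natCast, ← Real.rpow_mul (by linarith), Real.norm_eq_abs]
    refine Real.rpow_le_rpow_of_exponent_le h1 ?_
    push_cast
    linarith
  obtain ⟨B, hB0, hB⟩ : ∃ B : ℝ, 0 ≤ B ∧ ∫⁻ x, b x = ENNReal.ofReal B :=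
    ⟨_, ENNReal.toReal_nonneg, (ENNReal.ofReal_toReal hbI.ne).symm⟩
  have h4 : 0 ≤ 4 ^ q * (2 * B) := by positivity
  refine ⟨1 + B + 4 ^ q * (2 * B), fun ε hε => ?_⟩
  have hpos : ∀ x, 0 < expWeight ε x := fun x => by unfold expWeight; positivity
  refine ⟨by unfold expWeight; fun_prop, fun x => ?_, fun x hx y hy => ?_, fun x hx y hy => ?_,
    fun x hx => ?_, ?_⟩
  · exact (one_le_one_add_abs_sq x).trans (sq_le_expWeight hε x)
  · unfold expWeight
    rw [abs_of_nonneg hx, abs_of_nonneg hy, abs_of_nonneg (add_nonneg hx hy), mul_add,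
      Real.exp_add]
    have h : (1 + (x + y)) ^ 2 ≤ (1 + x) ^ 2 * (1 + y) ^ 2 := by
      rw [← mul_pow]
      exact pow_le_pow_left₀ (by positivity) (by nlinarith) 2
    calc _ ≤ Real.exp (ε * x) * Real.exp (ε * y) * ((1 + x) ^ 2 * (1 + y) ^ 2) :=
          mul_le_mul_of_nonneg_left h (by positivity)
      _ = _ := by ring
  · have h : expWeight ε x ≤ expWeight ε (x + y) := by
      unfold expWeight
      rw [abs_of_nonneg hx, abs_of_nonneg (add_nonneg hx hy)]
      gcongr <;> linarith
    refine h.trans (le_mul_of_one_le_left (hpos _).le (by linarith))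
  · have hle : ∀ y ∈ Set.Ioo 0 x, ENNReal.ofReal (expWeight ε y ^ (-q)) *
        ENNReal.ofReal (expWeight ε (x - y) ^ (-q)) ≤
        ENNReal.ofReal (4 ^ q) * ENNReal.ofReal (expWeight ε x ^ (-q)) * (b y + b (x - y)) := by
      intro y hy
      have key : ∀ s t, 0 < t → s ∈ Set.Ioo 0 x → x ≤ 2 * s → t = (1 + |x - s|) ^ 2 →
          ENNReal.ofReal (expWeight ε s ^ (-q)) * ENNReal.ofReal (expWeight ε (x - s) ^ (-q)) ≤
          ENNReal.ofReal (4 ^ q) * (ENNReal.ofReal (expWeight ε x ^ (-q)) *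
            ENNReal.ofReal (t ^ (-q))) := by
        intro s t ht hs hxs hts
        rw [← ENNReal.ofReal_mul (by have := hpos s; positivity),
          ← ENNReal.ofReal_mul (by have := hpos x; positivity),
          ← Real.mul_rpow (hpos _).le (hpos _).le, ← Real.mul_rpow (hpos _).le ht.le]
        refine ofReal_rpow_neg_le (by linarith) (by norm_num) (mul_pos (hpos _) ht)
          (mul_pos (hpos _) (hpos _)) ?_
        rw [hts]
        exact expWeight_le_four_mul hs.1.le hs.2.le hxs
      -- One of `y`, `x - y` is at least `x / 2`; the other one supplies the integrable factor.
      rcases le_total x (2 * y) with h | h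
      · refine (key y _ (by positivity) hy h rfl).trans ?_
        rw [← mul_assoc]
        exact mul_le_mul_right le_add_self _
      · have := key (x - y) ((1 + |y|) ^ 2) (by positivity)
          ⟨by linarith [hy.2], by linarith [hy.1]⟩ (by linarith) (by rw [sub_sub_cancel])
        rw [sub_sub_cancel, mul_comm] at this
        refine this.trans ?_
        rw [← mul_assoc]
        exact mul_le_mul_right le_self_add _
    calc _ ≤ ∫⁻ y in Set.Ioo 0 x, ENNReal.ofReal (4 ^ q) *
          ENNReal.ofReal (expWeight ε x ^ (-q)) * (b y + b (x - y)) :=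
          setLIntegral_mono' measurableSet_Ioo hle
      _ ≤ ∫⁻ y, ENNReal.ofReal (4 ^ q) *
          ENNReal.ofReal (expWeight ε x ^ (-q)) * (b y + b (x - y)) :=
          setLIntegral_le_lintegral _ _
      _ = ENNReal.ofReal (4 ^ q) * ENNReal.ofReal (expWeight ε x ^ (-q)) *
          (2 * ENNReal.ofReal B) := by
        rw [lintegral_const_mul' _ _ (by finiteness), lintegral_add_left hbm,
          lintegral_sub_left_eq_self b x, hB, two_mul]
      _ = ENNReal.ofReal (4 ^ q * (2 * B)) * ENNReal.ofReal (expWeight ε x ^ (-q)) := by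
        rw [ENNReal.ofReal_mul (by positivity), ENNReal.ofReal_mul (by positivity),
          ENNReal.ofReal_ofNat]
        ring
      _ ≤ _ := mul_le_mul_left (ENNReal.ofReal_le_ofReal (by linarith)) _
  · refine (setLIntegral_le_lintegral _ _).trans ((lintegral_mono fun x => ?_).trans
      (hB.le.trans (ENNReal.ofReal_le_ofReal (by linarith))))
    refine ENNReal.ofReal_le_ofReal ?_
    exact Real.rpow_le_rpow_of_nonpos (by positivity) (sq_le_expWeight hε x) (by linarith)

theorem exists_one_add_sq_le_exp {c : ℝ} (hc : 0 < c) :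
    ∃ K > 0, ∀ x ≥ 0, (1 + x) ^ 2 ≤ K * Real.exp (c * x) := by
  refine ⟨(1 + 2 / c) ^ 2, by positivity, fun x hx => ?_⟩
  have h1 : 1 + x ≤ (1 + 2 / c) * Real.exp (c / 2 * x) := by
    have h2 := Real.add_one_le_exp (c / 2 * x)
    have h3 : (1 + 2 / c) * (c / 2 * x + 1) = 1 + x + (c / 2 * x + 2 / c) := by
      field_simp
      ring
    have h4 : 0 ≤ c / 2 * x + 2 / c := by positivity
    nlinarith [mul_le_mul_of_nonneg_left h2 (by positivity : 0 ≤ 1 + 2 / c)]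
  calc (1 + x) ^ 2 ≤ ((1 + 2 / c) * Real.exp (c / 2 * x)) ^ 2 :=
        pow_le_pow_left₀ (by positivity) h1 2
    _ = (1 + 2 / c) ^ 2 * Real.exp (c * x) := by
      rw [mul_pow, ← Real.exp_nat_mul]
      push_cast
      ring_nf

open Classical in
/-- The right half of a weight: `ω` itself if it has subexponential growth on the right,
and `e^{εx} (1 + x)²` otherwise. -/
def rightHalf (ω : ℝ → ℝ) (ε : ℝ) : ℝ → ℝ := if rho₂ ω = 0 then ω else expWeight ε

/-- `K` precedes `ε`, as the later choice of `ε` requires. If the rate is positive, `ω` dominates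
`e^{ρ₂x}`; for `ε` below half the rate, the other half pays for the polynomial. In the bound
`e^{2εx}` the second `ε` does so. -/
theorem exists_rightHalf (hq : 1 ≤ q) (hω : IsAlmostMonotoneAlgebraWeight q ω) :
    ∃ K > 0, ∃ ε₀ > 0, ∀ ε > 0, ε < ε₀ → IsHalfLineWeight q K (rightHalf ω ε) ∧
      (∀ x ≥ 0, rightHalf ω ε x ≤ K * ω x) ∧
      ∃ C, ∀ x ≥ 0, rightHalf ω ε x ≤ C * Real.exp (2 * ε * x) := by
  by_cases h : rho₂ ω = 0
  · obtain ⟨K, hK⟩ := hω.exists_isHalfLineWeight h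
    refine ⟨K, one_pos.trans_le hK.one_le_const, 1, one_pos, fun ε hε _ => ?_⟩
    rw [rightHalf, if_pos h]
    refine ⟨hK, fun x _ => le_mul_of_one_le_left (hω.toIsWeight.pos x).le hK.one_le_const, ?_⟩
    exact hω.toIsWeight.exists_le_exp h (by positivity)
  · have hpos : 0 < rho₂ ω := lt_of_le_of_ne hω.toIsWeight.rho₂_nonneg (Ne.symm h)
    obtain ⟨K, hK⟩ := exists_isHalfLineWeight_expWeight hq
    obtain ⟨K', hK', hle⟩ := exists_one_add_sq_le_exp (half_pos hpos)
    refine ⟨K + K', by linarith [(hK 0 le_rfl).one_le_const], rho₂ ω / 2, half_pos hpos,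
      fun ε hε hε₀ => ?_⟩
    rw [rightHalf, if_neg h]
    refine ⟨(hK ε hε.le).mono (by linarith), fun x hx => ?_, ?_⟩
    · have h1 := hω.toIsWeight.exp_rho₂_mul_le hx
      have h2 : Real.exp (ε * x) * Real.exp (rho₂ ω / 2 * x) ≤ ω x := by
        rw [← Real.exp_add]
        refine le_trans (Real.exp_le_exp.2 ?_) h1
        nlinarith
      calc expWeight ε x = Real.exp (ε * x) * (1 + x) ^ 2 := by
            rw [expWeight, abs_of_nonneg hx]
        _ ≤ Real.exp (ε * x) * (K' * Real.exp (rho₂ ω / 2 * x)) :=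
          mul_le_mul_of_nonneg_left (hle x hx) (Real.exp_pos _).le
        _ = K' * (Real.exp (ε * x) * Real.exp (rho₂ ω / 2 * x)) := by ring
        _ ≤ K' * ω x := mul_le_mul_of_nonneg_left h2 hK'.le
        _ ≤ _ := mul_le_mul_of_nonneg_right
          (by linarith [(hK 0 le_rfl).one_le_const]) (hω.toIsWeight.pos x).le
    · obtain ⟨C, hC, hle'⟩ := exists_one_add_sq_le_exp hε
      refine ⟨C, fun x hx => ?_⟩
      calc expWeight ε x = Real.exp (ε * x) * (1 + x) ^ 2 := by
            rw [expWeight, abs_of_nonneg hx]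
        _ ≤ Real.exp (ε * x) * (C * Real.exp (ε * x)) :=
          mul_le_mul_of_nonneg_left (hle' x hx) (Real.exp_pos _).le
        _ = C * Real.exp (2 * ε * x) := by
          rw [mul_left_comm, ← Real.exp_add]
          ring_nf

/-- Every almost monotone algebra weight dominates almost monotone algebra weights of arbitrarily
small exponential growth, and no loss is needed if the weight is admissible. -/
theorem exists_small_weights (hq : 1 ≤ q) (hω : IsAlmostMonotoneAlgebraWeight q ω) :
    ∃ ν : ℝ → ℝ → ℝ, ∃ K > 0, ∃ ε₀ > 0, ∀ ε > 0, ε < ε₀ →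
      IsAlmostMonotoneAlgebraWeight q (ν ε) ∧ (∀ x, ν ε x ≤ K * ω x) ∧
      (∃ C, ∀ x, ν ε x ≤ C * Real.exp (2 * ε * |x|)) ∧
      (IsAdmissible ω → ∀ x, ω x ≤ ν ε x) := by
  obtain ⟨K₁, hK₁, ε₁, hε₁, h₁⟩ := exists_rightHalf hq hω
  obtain ⟨K₂, hK₂, ε₂, hε₂, h₂⟩ := exists_rightHalf hq hω.comp_neg
  set K := K₁ + K₂ with hK
  have hK0 : 0 < K := by positivity
  set C := K + 4 * K ^ q * K with hC
  have hC0 : 0 < C := by positivity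
  refine ⟨fun ε x => C * glue (rightHalf ω ε) (rightHalf (fun x => ω (-x)) ε) x, C * K,
    by positivity, min ε₁ ε₂, lt_min hε₁ hε₂, fun ε hε hlt => ?_⟩
  obtain ⟨hu, hu', D₁, hD₁⟩ := h₁ ε hε (hlt.trans_le (min_le_left _ _))
  obtain ⟨hv, hv', D₂, hD₂⟩ := h₂ ε hε (hlt.trans_le (min_le_right _ _))
  replace hu := hu.mono (by linarith : K₁ ≤ K)
  replace hv := hv.mono (by linarith : K₂ ≤ K)
  have hKC : K ≤ C := le_add_of_nonneg_right (by positivity)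
  have hωp := hω.toIsWeight.pos
  refine ⟨isAlmostMonotoneAlgebraWeight_glue hq hu hv le_rfl, fun x => ?_,
    ⟨C * max D₁ D₂, fun x => ?_⟩, fun had x => ?_⟩
  · rw [mul_assoc]
    refine mul_le_mul_of_nonneg_left ?_ hC0.le
    rcases le_or_gt 0 x with hx | hx
    · rw [glue_of_nonneg hx]
      exact (hu' x hx).trans (mul_le_mul_of_nonneg_right (by linarith) (hωp x).le)
    · rw [glue_of_neg hx]
      have := hv' (-x) (by linarith)
      rw [neg_neg] at this
      exact this.trans (mul_le_mul_of_nonneg_right (by linarith) (hωp x).le)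
  · rw [mul_assoc]
    refine mul_le_mul_of_nonneg_left ?_ hC0.le
    rcases le_or_gt 0 x with hx | hx
    · rw [glue_of_nonneg hx, abs_of_nonneg hx]
      exact (hD₁ x hx).trans (mul_le_mul_of_nonneg_right (le_max_left _ _) (Real.exp_pos _).le)
    · rw [glue_of_neg hx, abs_of_neg hx]
      exact (hD₂ (-x) (by linarith)).trans
        (mul_le_mul_of_nonneg_right (le_max_right _ _) (Real.exp_pos _).le)
  · have hg : glue (rightHalf ω ε) (rightHalf (fun x => ω (-x)) ε) x = ω x := by
      have h2 : (rho₂ fun x => ω (-x)) = 0 := by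
        rw [hω.toIsWeight.rho₂_comp_neg, had.1, neg_zero]
      rw [rightHalf, rightHalf, if_pos had.2, if_pos h2, glue]
      simp
    beta_reduce
    rw [hg]
    exact le_mul_of_one_le_left (hωp x).le (hu.one_le_const.trans hKC)

end SmallWeights

/-! ### Weighted `L^p` estimates for convolutions. -/

section WeightedNorms

/-- The convolution of `[0, ∞]`-valued functions. -/
def lconv (ρ φ : ℝ → ENNReal) (x : ℝ) : ENNReal := ∫⁻ y, ρ y * φ (x - y)

variable {ρ φ ψ : ℝ → ENNReal}

theorem measurable_lconv (hρ : Measurable ρ) (hφ : Measurable φ) : Measurable (lconv ρ φ) := by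
  have : Measurable fun z : ℝ × ℝ => ρ z.2 * φ (z.1 - z.2) := by fun_prop
  exact this.lintegral_prod_right'

theorem lconv_comm (ρ φ : ℝ → ENNReal) : lconv ρ φ = lconv φ ρ := by
  ext x
  rw [lconv, ← lintegral_sub_left_eq_self _ x, lconv]
  refine lintegral_congr fun y => ?_
  rw [sub_sub_cancel, mul_comm]

theorem lconv_add_right (ρ : ℝ → ENNReal) (hρ : Measurable ρ) (hφ : Measurable φ)
    (ψ : ℝ → ENNReal) : lconv ρ (φ + ψ) = lconv ρ φ + lconv ρ ψ := by
  ext x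
  simp only [lconv, Pi.add_apply, mul_add]
  exact lintegral_add_left (by fun_prop) _

theorem lconv_add_left (hρ : Measurable ρ) (hφ : Measurable φ) (ψ : ℝ → ENNReal) :
    lconv (φ + ψ) ρ = lconv φ ρ + lconv ψ ρ := by
  rw [lconv_comm, lconv_add_right ρ hρ hφ, lconv_comm φ, lconv_comm ψ]

theorem lconv_mono_ae (ρ : ℝ → ENNReal) (h : φ ≤ᵐ[volume] ψ) : lconv ρ φ ≤ lconv ρ ψ := by
  intro x
  refine lintegral_mono_ae ?_
  filter_upwards [(Measure.measurePreserving_sub_left volume x).quasiMeasurePreserving.ae h]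
    with y hy
  exact mul_le_mul_right hy _

theorem lintegral_lconv (hρ : Measurable ρ) (hφ : Measurable φ) :
    ∫⁻ x, lconv ρ φ x = (∫⁻ x, ρ x) * ∫⁻ x, φ x :=
  lintegral_lintegral_mul_sub hρ.aemeasurable hφ.aemeasurable

/-- The norm of `φ` in `L^p` with respect to the translated weight `ν(· - s)`. -/
def wnorm (p : ℝ) (ν : ℝ → ℝ) (s : ℝ) (φ : ℝ → ENNReal) : ENNReal :=
  (∫⁻ x, (φ x * ENNReal.ofReal (ν (x - s))) ^ p) ^ (1 / p)

variable {p q : ℝ} {ν : ℝ → ℝ}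

theorem wnorm_mono_ae (hp : 0 ≤ p) (h : φ ≤ᵐ[volume] ψ) (s : ℝ) :
    wnorm p ν s φ ≤ wnorm p ν s ψ := by
  refine ENNReal.rpow_le_rpow (lintegral_mono_ae ?_) (by positivity)
  filter_upwards [h] with x hx
  exact ENNReal.rpow_le_rpow (mul_le_mul_left hx _) hp

theorem wnorm_rpow (hp : 0 < p) (s : ℝ) (φ : ℝ → ENNReal) :
    wnorm p ν s φ ^ p = ∫⁻ x, (φ x * ENNReal.ofReal (ν (x - s))) ^ p := by
  rw [wnorm, ← ENNReal.rpow_mul, one_div_mul_cancel hp.ne', ENNReal.rpow_one]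

theorem wnorm_add_le (hp : 1 ≤ p) (hν : Measurable ν) (hφ : Measurable φ) (hψ : Measurable ψ)
    (s : ℝ) : wnorm p ν s (φ + ψ) ≤ wnorm p ν s φ + wnorm p ν s ψ := by
  have h := ENNReal.lintegral_Lp_add_le (μ := volume)
    (f := fun x => φ x * ENNReal.ofReal (ν (x - s)))
    (g := fun x => ψ x * ENNReal.ofReal (ν (x - s))) (by fun_prop) (by fun_prop) hp
  refine le_trans (le_of_eq ?_) h
  simp [wnorm, add_mul]

/-- Translating the weight, for weights of exponential growth. -/
theorem wnorm_le_exp_mul (hp : 0 < p) (hν : IsWeight ν) {δ C : ℝ}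
    (hC : ∀ x, ν x ≤ C * Real.exp (δ * |x|)) (s : ℝ) (φ : ℝ → ENNReal) :
    wnorm p ν s φ ≤ ENNReal.ofReal C * ENNReal.ofReal (Real.exp (δ * |s|)) * wnorm p ν 0 φ := by
  rw [← ENNReal.rpow_le_rpow_iff hp, ENNReal.mul_rpow_of_nonneg _ _ hp.le, wnorm_rpow hp,
    wnorm_rpow hp, ← lintegral_const_mul' _ _ (by finiteness)]
  refine lintegral_mono fun x => ?_
  rw [← ENNReal.mul_rpow_of_nonneg _ _ hp.le]
  refine ENNReal.rpow_le_rpow ?_ hp.le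
  have hC0 : 0 ≤ C := by simpa using (hν.pos 0).le.trans (hC 0)
  rw [← ENNReal.ofReal_mul hC0, sub_zero, mul_left_comm,
    ← ENNReal.ofReal_mul (by positivity)]
  refine mul_le_mul_right (ENNReal.ofReal_le_ofReal ?_) _
  have h1 := hC (-s)
  rw [abs_neg] at h1
  calc ν (x - s) ≤ ν x * ν (-s) := hν.map_add_le x (-s)
    _ ≤ ν x * (C * Real.exp (δ * |s|)) := mul_le_mul_of_nonneg_left h1 (hν.pos x).le
    _ = _ := mul_comm _ _

/-- Weighted Jensen inequality. -/
theorem lintegral_mul_rpow_le (hpq : p.HolderConjugate q) {f g : ℝ → ENNReal} (hf : Measurable f)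
    (hg : Measurable g) :
    (∫⁻ y, f y * g y) ^ p ≤ (∫⁻ y, f y) ^ (p - 1) * ∫⁻ y, f y * g y ^ p := by
  have hp := hpq.pos
  have hq := hpq.symm.pos
  have h := ENNReal.lintegral_mul_le_Lp_mul_Lq (volume : Measure ℝ) hpq
    (f := fun y => f y ^ (1 / p) * g y) (g := fun y => f y ^ (1 / q)) (by fun_prop) (by fun_prop)
  have h1 : ∀ y, ((fun y => f y ^ (1 / p) * g y) * fun y => f y ^ (1 / q)) y = f y * g y := by
    intro y
    simp only [Pi.mul_apply]
    rw [mul_right_comm, ← ENNReal.rpow_add_of_nonneg _ _ (by positivity) (by positivity)]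
    rw [one_div, one_div, hpq.inv_add_inv_eq_one, ENNReal.rpow_one]
  have h2 : ∀ y, (f y ^ (1 / p) * g y) ^ p = f y * g y ^ p := by
    intro y
    rw [ENNReal.mul_rpow_of_nonneg _ _ hp.le, ← ENNReal.rpow_mul, one_div_mul_cancel hp.ne',
      ENNReal.rpow_one]
  have h3 : ∀ y, (f y ^ (1 / q)) ^ q = f y := by
    intro y
    rw [← ENNReal.rpow_mul, one_div_mul_cancel hq.ne', ENNReal.rpow_one]
  simp only [h1, h2, h3] at h
  calc (∫⁻ y, f y * g y) ^ p ≤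
      ((∫⁻ y, f y * g y ^ p) ^ (1 / p) * (∫⁻ y, f y) ^ (1 / q)) ^ p :=
        ENNReal.rpow_le_rpow h hp.le
    _ = _ := by
      rw [ENNReal.mul_rpow_of_nonneg _ _ hp.le, ← ENNReal.rpow_mul, ← ENNReal.rpow_mul,
        one_div_mul_cancel hp.ne', ENNReal.rpow_one, mul_comm]
      congr 2
      have := hpq.sub_one_mul_conj
      field_simp
      linarith

/-- Convolution with a function supported in `[-N, N]` is bounded on weighted `L^p` by the
`L¹`-norm, up to the oscillation of the weight. -/
theorem wnorm_lconv_le_of_support (hpq : p.HolderConjugate q) (hν : Measurable ν)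
    (hρ : Measurable ρ) (hφ : Measurable φ) {δ N : ℝ} (hδ : 0 ≤ δ) (hN : ∀ y, N < |y| → ρ y = 0)
    {M : ENNReal} (hM : ∀ s, wnorm p ν s φ ≤ M * ENNReal.ofReal (Real.exp (δ * |s|))) (s : ℝ) :
    wnorm p ν s (lconv ρ φ) ≤ (ENNReal.ofReal (Real.exp (δ * N)) * ∫⁻ y, ρ y) *
      (M * ENNReal.ofReal (Real.exp (δ * |s|))) := by
  have hp := hpq.pos
  rw [← ENNReal.rpow_le_rpow_iff hp, wnorm_rpow hp]
  set w : ℝ → ENNReal := fun x => ENNReal.ofReal (ν x) with hw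
  have hwm : Measurable w := by fun_prop
  set I := ∫⁻ y, ρ y with hI
  calc ∫⁻ x, (lconv ρ φ x * w (x - s)) ^ p
      = ∫⁻ x, (∫⁻ y, ρ y * (φ (x - y) * w (x - s))) ^ p := by
        refine lintegral_congr fun x => ?_
        rw [lconv, ← lintegral_mul_const' _ _ ENNReal.ofReal_ne_top]
        simp only [mul_assoc, hw]
    _ ≤ ∫⁻ x, I ^ (p - 1) * ∫⁻ y, ρ y * (φ (x - y) * w (x - s)) ^ p :=
        lintegral_mono fun x => lintegral_mul_rpow_le hpq hρ (by fun_prop)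
    _ = I ^ (p - 1) * ∫⁻ x, ∫⁻ y, ρ y * (φ (x - y) * w (x - s)) ^ p := by
        refine lintegral_const_mul _ ?_
        have : Measurable fun z : ℝ × ℝ => ρ z.2 * (φ (z.1 - z.2) * w (z.1 - s)) ^ p := by fun_prop
        exact this.lintegral_prod_right'
    -- Translating `φ` by `y` moves the base point of the weight from `s` to `s - y`; this is why
    -- the hypothesis covers all translates.
    _ = I ^ (p - 1) * ∫⁻ y, ρ y * wnorm p ν (s - y) φ ^ p := by
        congr 1
        rw [lintegral_lintegral_swap (by
          refine Measurable.aemeasurable ?_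
          unfold Function.uncurry
          fun_prop)]
        refine lintegral_congr fun y => ?_
        rw [lintegral_const_mul _ (by fun_prop), wnorm_rpow hp,
          ← lintegral_sub_right_eq_self (fun x => (φ x * ENNReal.ofReal (ν (x - (s - y)))) ^ p) y]
        congr 1
        refine lintegral_congr fun x => ?_
        rw [hw, show x - y - (s - y) = x - s by ring]
    _ ≤ I ^ (p - 1) * ∫⁻ y, ρ y * (ENNReal.ofReal (Real.exp (δ * N)) *
          (M * ENNReal.ofReal (Real.exp (δ * |s|)))) ^ p := by
        refine mul_le_mul_right (lintegral_mono fun y => ?_) _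
        rcases lt_or_ge N |y| with hy | hy
        · simp [hN y hy]
        refine mul_le_mul_right (ENNReal.rpow_le_rpow ((hM _).trans ?_) hp.le) _
        rw [mul_left_comm, ← ENNReal.ofReal_mul (Real.exp_pos _).le, ← Real.exp_add]
        refine mul_le_mul_right (ENNReal.ofReal_le_ofReal (Real.exp_le_exp.2 ?_)) _
        rw [← mul_add]
        refine mul_le_mul_of_nonneg_left ?_ hδ
        linarith [abs_sub s y]
    _ = _ := by
        rw [lintegral_mul_const _ hρ, ← hI, ← mul_assoc]
        have : I ^ (p - 1) * I = I ^ p := by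
          nth_rewrite 2 [← ENNReal.rpow_one I]
          rw [← ENNReal.rpow_add_of_nonneg _ _ (by linarith [hpq.lt]) zero_le_one,
            sub_add_cancel]
        rw [this, ← ENNReal.mul_rpow_of_nonneg _ _ hp.le]
        ring_nf

/-- The weighted `L^p` space of an algebra weight is a convolution algebra. -/
theorem wnorm_lconv_le (hpq : p.HolderConjugate q) (hν : IsAlmostMonotoneAlgebraWeight q ν)
    (hρ : Measurable ρ) (hφ : Measurable φ) (s : ℝ) :
    wnorm p ν s (lconv ρ φ) ≤ wnorm p ν 0 ρ * wnorm p ν s φ := by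
  have hp := hpq.pos
  have hq := hpq.symm.pos
  have hνm := hν.measurable
  have hpos := hν.toIsWeight.pos
  rw [← ENNReal.rpow_le_rpow_iff hp, ENNReal.mul_rpow_of_nonneg _ _ hp.le, wnorm_rpow hp,
    wnorm_rpow hp, wnorm_rpow hp]
  simp only [sub_zero]
  set w : ℝ → ENNReal := fun x => ENNReal.ofReal (ν x) with hw
  have hwm : Measurable w := by fun_prop
  have hw0 : ∀ x, w x ≠ 0 := fun x => by simpa [hw] using hpos x
  have hwt : ∀ x, w x ≠ ⊤ := fun x => ENNReal.ofReal_ne_top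
  have hwq : ∀ x, ENNReal.ofReal (ν x ^ (-q)) = ((w x)⁻¹) ^ q := fun x => by
    rw [hw, ENNReal.inv_rpow, ← ENNReal.rpow_neg, ENNReal.ofReal_rpow_of_pos (hpos x)]
  have key : ∀ x, (lconv ρ φ x * w (x - s)) ^ p ≤
      ∫⁻ y, (ρ y * w y) ^ p * (φ (x - y) * w (x - y - s)) ^ p := by
    intro x
    -- The weights are inserted and divided out; by the convolution inequality for `ν^{-q}` the
    -- reciprocals contribute at most `(w (x - s))⁻¹`.
    have h := ENNReal.lintegral_mul_le_Lp_mul_Lq (volume : Measure ℝ) hpq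
      (f := fun y => (ρ y * w y) * (φ (x - y) * w (x - y - s)))
      (g := fun y => (w y)⁻¹ * (w (x - s - y))⁻¹) (by fun_prop) (by fun_prop)
    have h1 : ∀ y, ((fun y => (ρ y * w y) * (φ (x - y) * w (x - y - s))) *
        fun y => (w y)⁻¹ * (w (x - s - y))⁻¹) y = ρ y * φ (x - y) := by
      intro y
      simp only [Pi.mul_apply]
      rw [show x - s - y = x - y - s by ring]
      calc _ = (ρ y * φ (x - y)) * (w y * (w y)⁻¹) * (w (x - y - s) * (w (x - y - s))⁻¹) := by
            ring
        _ = _ := by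
          rw [ENNReal.mul_inv_cancel (hw0 _) (hwt _), ENNReal.mul_inv_cancel (hw0 _) (hwt _),
            mul_one, mul_one]
    have h2 : ∫⁻ y, ((w y)⁻¹ * (w (x - s - y))⁻¹) ^ q ≤ ((w (x - s))⁻¹) ^ q := by
      have := hν.conv_le (x - s)
      simp only [hwq] at this
      refine le_trans (le_of_eq (lintegral_congr fun y => ?_)) this
      rw [ENNReal.mul_rpow_of_nonneg _ _ hq.le]
    have h3 : (∫⁻ y, ((w y)⁻¹ * (w (x - s - y))⁻¹) ^ q) ^ (1 / q) ≤ (w (x - s))⁻¹ := by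
      refine (ENNReal.rpow_le_rpow h2 (by positivity)).trans (le_of_eq ?_)
      rw [← ENNReal.rpow_mul, mul_one_div_cancel hq.ne', ENNReal.rpow_one]
    simp only [h1] at h
    have h4 : lconv ρ φ x * w (x - s) ≤
        (∫⁻ y, (ρ y * w y * (φ (x - y) * w (x - y - s))) ^ p) ^ (1 / p) := by
      calc lconv ρ φ x * w (x - s) ≤ ((∫⁻ y, (ρ y * w y * (φ (x - y) * w (x - y - s))) ^ p) ^
            (1 / p) * (w (x - s))⁻¹) * w (x - s) :=
            mul_le_mul_left (h.trans (mul_le_mul_right h3 _)) _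
        _ = _ := by rw [mul_assoc, ENNReal.inv_mul_cancel (hw0 _) (hwt _), mul_one]
    refine (ENNReal.rpow_le_rpow h4 hp.le).trans (le_of_eq ?_)
    rw [← ENNReal.rpow_mul, one_div_mul_cancel hp.ne', ENNReal.rpow_one]
    refine lintegral_congr fun y => ?_
    rw [ENNReal.mul_rpow_of_nonneg _ _ hp.le]
  refine (lintegral_mono key).trans (le_of_eq ?_)
  exact lintegral_lintegral_mul_sub (u := fun y => (ρ y * w y) ^ p)
    (v := fun y => (φ y * w (y - s)) ^ p) (by fun_prop) (by fun_prop)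

end WeightedNorms

/-! ### The renewal inequality and its Neumann series. -/

section Regularity

open Topology

variable {p q : ℝ} {ν : ℝ → ℝ} {ρ H : ℝ → ENNReal}

theorem measurable_iterate_lconv (hρ : Measurable ρ) (hH : Measurable H) (n : ℕ) :
    Measurable ((lconv ρ)^[n] H) := by
  induction n with
  | zero => exact hH
  | succ n ih =>
    rw [Function.iterate_succ_apply']
    exact measurable_lconv hρ ih

theorem lintegral_iterate_lconv (hρ : Measurable ρ) (hH : Measurable H) (n : ℕ) :
    ∫⁻ x, (lconv ρ)^[n] H x = (∫⁻ x, ρ x) ^ n * ∫⁻ x, H x := by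
  induction n with
  | zero => simp
  | succ n ih =>
    rw [Function.iterate_succ_apply', lintegral_lconv hρ (measurable_iterate_lconv hρ hH n), ih]
    ring

theorem le_sum_iterate_lconv (hρ : Measurable ρ) (h : H ≤ᵐ[volume] ρ + lconv ρ H) (n : ℕ) :
    H ≤ᵐ[volume] (∑ i ∈ Finset.range n, (lconv ρ)^[i] ρ) + (lconv ρ)^[n] H := by
  induction n with
  | zero =>
    simp only [Finset.range_zero, Finset.sum_empty, zero_add, Function.iterate_zero, id_eq]
    exact EventuallyLE.refl _ _
  | succ n ih =>
    have hsum : ∀ n, Measurable (∑ i ∈ Finset.range n, (lconv ρ)^[i] ρ) := fun n =>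
      Finset.sum_induction _ _ (fun _ _ => Measurable.add) measurable_zero fun i _ =>
        measurable_iterate_lconv hρ hρ i
    have hlin : ∀ n, lconv ρ (∑ i ∈ Finset.range n, (lconv ρ)^[i] ρ) =
        ∑ i ∈ Finset.range n, (lconv ρ)^[i + 1] ρ := fun n => by
      induction n with
      | zero =>
        ext x
        simp [lconv]
      | succ n ih =>
        rw [Finset.sum_range_succ, lconv_add_right ρ hρ (hsum n), ih, Finset.sum_range_succ,
          Function.iterate_succ_apply']
    refine h.trans ?_
    have h1 := lconv_mono_ae ρ ih
    rw [lconv_add_right ρ hρ (hsum n), hlin] at h1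
    refine Eventually.of_forall fun x => ?_
    have h2 : (∑ i ∈ Finset.range (n + 1), (lconv ρ)^[i] ρ) =
        ρ + ∑ i ∈ Finset.range n, (lconv ρ)^[i + 1] ρ := by
      rw [Finset.sum_range_succ', add_comm]
      rfl
    rw [h2, Function.iterate_succ_apply', add_assoc]
    exact add_le_add le_rfl (h1 x)

/-- A solution of the renewal inequality is dominated by the Neumann series. -/
theorem le_tsum_iterate_lconv (hρ : Measurable ρ) (hH : Measurable H) (hρ1 : ∫⁻ x, ρ x < 1)
    (hHt : ∫⁻ x, H x < ⊤) (h : H ≤ᵐ[volume] ρ + lconv ρ H) :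
    ∀ᵐ x, H x ≤ ∑' i, (lconv ρ)^[i] ρ x := by
  -- The remainders of the iterated inequality are summable almost everywhere because `∫ ρ < 1`, so
  -- they tend to zero.
  have hfin : ∫⁻ x, ∑' n, (lconv ρ)^[n] H x ≠ ⊤ := by
    rw [lintegral_tsum fun n => (measurable_iterate_lconv hρ hH n).aemeasurable]
    simp_rw [lintegral_iterate_lconv hρ hH]
    rw [ENNReal.tsum_mul_right, ENNReal.tsum_geometric]
    refine ENNReal.mul_ne_top (ENNReal.inv_ne_top.2 ?_) hHt.ne
    exact (tsub_pos_of_lt hρ1).ne'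
  have hm : Measurable fun x => ∑' n, (lconv ρ)^[n] H x :=
    Measurable.tsum fun n => measurable_iterate_lconv hρ hH n
  filter_upwards [ae_lt_top hm hfin, ae_all_iff.2 (le_sum_iterate_lconv hρ h)] with x hx hle
  have h0 : Tendsto (fun n => (lconv ρ)^[n] H x) atTop (𝓝 0) :=
    ENNReal.tendsto_atTop_zero_of_tsum_ne_top hx.ne
  have h1 : Tendsto (fun n => (∑' i, (lconv ρ)^[i] ρ x) + (lconv ρ)^[n] H x) atTop
      (𝓝 ((∑' i, (lconv ρ)^[i] ρ x) + 0)) := tendsto_const_nhds.add h0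
  rw [add_zero] at h1
  refine ge_of_tendsto' h1 fun n => (hle n).trans ?_
  rw [Pi.add_apply, Finset.sum_apply]
  exact add_le_add (ENNReal.sum_le_tsum _) le_rfl

theorem wnorm_tsum_le (hp : 1 ≤ p) (hν : Measurable ν) {φ : ℕ → ℝ → ENNReal}
    (hφ : ∀ n, Measurable (φ n)) (s : ℝ) :
    wnorm p ν s (fun x => ∑' n, φ n x) ≤ ∑' n, wnorm p ν s (φ n) := by
  have hp0 : 0 < p := one_pos.trans_le hp
  have hsum : ∀ n, Measurable (∑ i ∈ Finset.range n, φ i) := fun n =>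
    Finset.sum_induction _ _ (fun _ _ => Measurable.add) measurable_zero fun i _ =>
        hφ i
  have hfin : ∀ n, wnorm p ν s (∑ i ∈ Finset.range n, φ i) ≤
      ∑ i ∈ Finset.range n, wnorm p ν s (φ i) := by
    intro n
    induction n with
    | zero => simp [wnorm, hp0]
    | succ n ih =>
      rw [Finset.sum_range_succ, Finset.sum_range_succ]
      exact (wnorm_add_le hp hν (hsum n) (hφ n) s).trans (add_le_add ih le_rfl)
  rw [← ENNReal.rpow_le_rpow_iff hp0, wnorm_rpow hp0]
  have hlim := lintegral_tendsto_of_tendsto_of_monotone (μ := volume)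
    (f := fun n x => ((∑ i ∈ Finset.range n, φ i) x * ENNReal.ofReal (ν (x - s))) ^ p)
    (F := fun x => ((∑' n, φ n x) * ENNReal.ofReal (ν (x - s))) ^ p)
    (fun n => by have := hsum n; fun_prop) ?_ ?_
  · refine le_of_tendsto' hlim fun n => ?_
    rw [← wnorm_rpow hp0]
    exact ENNReal.rpow_le_rpow ((hfin n).trans (ENNReal.sum_le_tsum _)) hp0.le
  · refine Eventually.of_forall fun x m n hmn => ?_
    simp only [Finset.sum_apply]
    gcongr
  · refine Eventually.of_forall fun x => ?_
    simp only [Finset.sum_apply]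
    exact (ENNReal.continuous_rpow_const.tendsto _).comp
      (ENNReal.Tendsto.mul_const ENNReal.summable.hasSum.tendsto_sum_nat
        (Or.inr ENNReal.ofReal_ne_top))

/-- Solutions of the renewal inequality inherit integrability with respect to algebra weights of
small exponential growth. -/
theorem wnorm_lt_top_of_le (hpq : p.HolderConjugate q) (hν : IsAlmostMonotoneAlgebraWeight q ν)
    (hρ : Measurable ρ) (hH : Measurable H) (hρ1 : ∫⁻ x, ρ x < 1) (hHt : ∫⁻ x, H x < ⊤)
    (h : H ≤ᵐ[volume] ρ + lconv ρ H) {δ C N : ℝ} (hδ : 0 ≤ δ)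
    (hC : ∀ x, ν x ≤ C * Real.exp (δ * |x|)) (hρν : wnorm p ν 0 ρ < ⊤)
    (hθ : ENNReal.ofReal (Real.exp (δ * N)) * (∫⁻ y, ρ y) +
      wnorm p ν 0 ({y | N < |y|}.indicator ρ) < 1) :
    wnorm p ν 0 H < ⊤ := by
  have hp := hpq.pos
  set S : Set ℝ := {y | N < |y|} with hS
  have hSm : MeasurableSet S := measurableSet_lt measurable_const (by fun_prop)
  have hρS : Measurable (S.indicator ρ) := hρ.indicator hSm
  have hρS' : Measurable (Sᶜ.indicator ρ) := hρ.indicator hSm.compl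
  set θ := ENNReal.ofReal (Real.exp (δ * N)) * (∫⁻ y, ρ y) + wnorm p ν 0 (S.indicator ρ) with hθ'
  set M := ENNReal.ofReal C * wnorm p ν 0 ρ with hM
  -- The near part of `ρ` moves the base point, so the induction must carry all translates with
  -- growth `e^{δ|s|}`. The far part uses only the algebra property; together each convolution costs
  -- a factor `θ`.
  have hstep : ∀ n s, wnorm p ν s ((lconv ρ)^[n] ρ) ≤
      θ ^ n * M * ENNReal.ofReal (Real.exp (δ * |s|)) := by
    intro n
    induction n with
    | zero =>
      intro s
      refine (wnorm_le_exp_mul hp hν.toIsWeight hC s ρ).trans (le_of_eq ?_)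
      rw [hM]
      ring
    | succ n ih =>
      intro s
      set φ := (lconv ρ)^[n] ρ with hφ
      have hφm : Measurable φ := measurable_iterate_lconv hρ hρ n
      have hsplit : lconv ρ φ = lconv (Sᶜ.indicator ρ) φ + lconv (S.indicator ρ) φ := by
        rw [← lconv_add_left hφm hρS']
        rw [Set.indicator_compl_add_self]
      rw [Function.iterate_succ_apply', ← hφ, hsplit]
      refine (wnorm_add_le hpq.lt.le hν.measurable (measurable_lconv hρS' hφm)
        (measurable_lconv hρS hφm) s).trans ?_
      have h1 := wnorm_lconv_le_of_support hpq hν.measurable hρS' hφm hδ (N := N)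
        (fun y hy => Set.indicator_of_notMem (fun hc : y ∈ Sᶜ => hc hy) _) ih s
      have h2 := wnorm_lconv_le hpq hν hρS hφm s
      have h3 : ∫⁻ y, Sᶜ.indicator ρ y ≤ ∫⁻ y, ρ y :=
        lintegral_mono (Set.indicator_le_self _ _)
      calc _ ≤ (ENNReal.ofReal (Real.exp (δ * N)) * ∫⁻ y, ρ y) *
            (θ ^ n * M * ENNReal.ofReal (Real.exp (δ * |s|))) +
            wnorm p ν 0 (S.indicator ρ) * (θ ^ n * M * ENNReal.ofReal (Real.exp (δ * |s|))) :=
            add_le_add (h1.trans (mul_le_mul_left (mul_le_mul_right h3 _) _))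
              (h2.trans (mul_le_mul_right (ih s) _))
        _ = _ := by
          rw [← add_mul, ← hθ']
          ring
  have hle := le_tsum_iterate_lconv hρ hH hρ1 hHt h
  refine (wnorm_mono_ae hp.le hle 0).trans_lt ?_
  refine (wnorm_tsum_le hpq.lt.le hν.measurable
    (fun n => measurable_iterate_lconv hρ hρ n) 0).trans_lt ?_
  have hbound : ∑' n, wnorm p ν 0 ((lconv ρ)^[n] ρ) ≤ ∑' n, θ ^ n * M := by
    refine ENNReal.tsum_le_tsum fun n => ?_
    simpa using hstep n 0
  refine hbound.trans_lt ?_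
  rw [ENNReal.tsum_mul_right, ENNReal.tsum_geometric]
  refine ENNReal.mul_lt_top (ENNReal.inv_lt_top.2 (tsub_pos_of_lt hθ)) ?_
  exact ENNReal.mul_lt_top ENNReal.ofReal_lt_top hρν

end Regularity

/-! ### Weighted `L^p` membership and its transfer to small weights. -/

section Membership

open Topology

theorem wnorm_le_of_le {p : ℝ} {ω ν : ℝ → ℝ} (hp : 0 < p) {K : ℝ} (hK : 0 ≤ K)
    (hle : ∀ x, ν x ≤ K * ω x) (s : ℝ) (φ : ℝ → ENNReal) :
    wnorm p ν s φ ≤ ENNReal.ofReal K * wnorm p ω s φ := by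
  rw [← ENNReal.rpow_le_rpow_iff hp, ENNReal.mul_rpow_of_nonneg _ _ hp.le, wnorm_rpow hp,
    wnorm_rpow hp, ← lintegral_const_mul' _ _ (by finiteness)]
  refine lintegral_mono fun x => ?_
  rw [← ENNReal.mul_rpow_of_nonneg _ _ hp.le]
  refine ENNReal.rpow_le_rpow ?_ hp.le
  rw [mul_left_comm, ← ENNReal.ofReal_mul hK]
  exact mul_le_mul_right (ENNReal.ofReal_le_ofReal (hle _)) _

variable {A : Type*} [NormedRing A] {p q : ℝ} {ω ν : ℝ → ℝ} {f g : ℝ → A}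

theorem memWeightedLp_iff (hp : 0 < p) (hω : ∀ x, 0 < ω x) :
    MemWeightedLp p ω f ↔ AEStronglyMeasurable f ∧ wnorm p ω 0 (fun x => ‖f x‖ₑ) < ⊤ := by
  rw [MemWeightedLp, wnorm, ENNReal.rpow_lt_top_iff_of_pos (by positivity)]
  refine and_congr_right fun _ => ?_
  refine Iff.of_eq (congrArg (· < ⊤) (lintegral_congr fun x => ?_))
  rw [sub_zero, ← Real.mul_rpow (norm_nonneg _) (hω x).le,
    ← ENNReal.ofReal_rpow_of_nonneg (mul_nonneg (norm_nonneg _) (hω x).le) hp.le,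
    ENNReal.ofReal_mul (norm_nonneg _), ofReal_norm]

theorem MemWeightedLp.congr_ae (hf : MemWeightedLp p ω f) (h : f =ᵐ[volume] g) :
    MemWeightedLp p ω g := by
  refine ⟨hf.1.congr h, lt_of_eq_of_lt (lintegral_congr_ae ?_) hf.2⟩
  filter_upwards [h] with x hx
  rw [hx]

theorem MemWeightedLp.exists_stronglyMeasurable (hf : MemWeightedLp p ω f) :
    ∃ f' : ℝ → A, StronglyMeasurable f' ∧ f =ᵐ[volume] f' ∧ MemWeightedLp p ω f' :=
  ⟨hf.1.mk f, hf.1.stronglyMeasurable_mk, hf.1.ae_eq_mk, hf.congr_ae hf.1.ae_eq_mk⟩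

theorem MemWeightedLp.mono_weight (hp : 0 < p) (hω : ∀ x, 0 < ω x) (hν : ∀ x, 0 < ν x) {K : ℝ}
    (hK : 0 ≤ K) (hle : ∀ x, ν x ≤ K * ω x) (hf : MemWeightedLp p ω f) :
    MemWeightedLp p ν f := by
  rw [memWeightedLp_iff hp hω] at hf
  rw [memWeightedLp_iff hp hν]
  exact ⟨hf.1, (wnorm_le_of_le hp hK hle 0 _).trans_lt
    (ENNReal.mul_lt_top ENNReal.ofReal_lt_top hf.2)⟩

theorem MemWeightedLp.add (hp : 1 ≤ p) (hω : IsWeight ω) (hf : MemWeightedLp p ω f)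
    (hg : MemWeightedLp p ω g) : MemWeightedLp p ω (f + g) := by
  obtain ⟨f', hf'm, hff', hf'⟩ := hf.exists_stronglyMeasurable
  obtain ⟨g', hg'm, hgg', hg'⟩ := hg.exists_stronglyMeasurable
  refine MemWeightedLp.congr_ae ?_ (hff'.add hgg').symm
  have hp0 : 0 < p := one_pos.trans_le hp
  rw [memWeightedLp_iff hp0 hω.pos] at hf' hg' ⊢
  refine ⟨hf'.1.add hg'.1, lt_of_le_of_lt ?_ (ENNReal.add_lt_top.2 ⟨hf'.2, hg'.2⟩)⟩
  refine le_trans ?_ (wnorm_add_le hp hω.measurable hf'm.enorm hg'm.enorm 0)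
  exact wnorm_mono_ae hp0.le (Eventually.of_forall fun x => enorm_add_le _ _) 0

/-- Weighted `L^p` functions are integrable if `ω^{-q}` is. -/
theorem MemWeightedLp.integrable (hpq : p.HolderConjugate q)
    (hω : IsAlmostMonotoneAlgebraWeight q ω) (hf : MemWeightedLp p ω f) : Integrable f := by
  have hp := hpq.pos
  have hq := hpq.symm.pos
  have hpos := hω.toIsWeight.pos
  have hωm := hω.measurable
  rw [memWeightedLp_iff hp hpos] at hf
  refine ⟨hf.1, ?_⟩
  have hfm := hf.1.enorm
  have h := ENNReal.lintegral_mul_le_Lp_mul_Lq (volume : Measure ℝ) hpq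
    (f := fun x => ‖f x‖ₑ * ENNReal.ofReal (ω x)) (g := fun x => (ENNReal.ofReal (ω x))⁻¹)
    (by fun_prop) (by fun_prop)
  have h1 : ∀ x, ((fun x => ‖f x‖ₑ * ENNReal.ofReal (ω x)) *
      fun x => (ENNReal.ofReal (ω x))⁻¹) x = ‖f x‖ₑ := by
    intro x
    rw [Pi.mul_apply, mul_assoc, ENNReal.mul_inv_cancel (by simpa using hpos x)
      ENNReal.ofReal_ne_top, mul_one]
  have h2 : ∀ x, ((ENNReal.ofReal (ω x))⁻¹) ^ q = ENNReal.ofReal (ω x ^ (-q)) := by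
    intro x
    rw [ENNReal.inv_rpow, ← ENNReal.rpow_neg, ENNReal.ofReal_rpow_of_pos (hpos x)]
  simp only [h1, h2] at h
  refine h.trans_lt (ENNReal.mul_lt_top ?_ ?_)
  · simpa [wnorm] using hf.2
  · exact ENNReal.rpow_lt_top_of_nonneg (by positivity) hω.lintegral_lt_top.ne

theorem memWeightedLp_of_hasCompactSupport (hp : 0 < p) (hω : IsWeight ω) (hf : Continuous f)
    (hfc : HasCompactSupport f) : MemWeightedLp p ω f := by
  refine ⟨hf.aestronglyMeasurable, ?_⟩
  obtain ⟨N, hN⟩ := hfc.isCompact.isBounded.subset_closedBall 0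
  obtain ⟨C, hC⟩ := hω.exists_bound N
  obtain ⟨D, hD⟩ := hf.bounded_above_of_compact_support hfc
  have hle : ∀ x, ENNReal.ofReal (‖f x‖ ^ p * ω x ^ p) ≤
      (Metric.closedBall (0 : ℝ) N).indicator (fun _ => ENNReal.ofReal (D ^ p * C ^ p)) x := by
    intro x
    by_cases hx : x ∈ Metric.closedBall (0 : ℝ) N
    · rw [Set.indicator_of_mem hx]
      refine ENNReal.ofReal_le_ofReal ?_
      have h1 := hC x (by simpa using hx)
      have h2 := hD x
      have h3 := (hω.pos x).le
      have h4 := (norm_nonneg _).trans h2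
      gcongr
    · rw [image_eq_zero_of_notMem_tsupport fun h => hx (hN h)]
      simp [Real.zero_rpow hp.ne']
  refine (lintegral_mono hle).trans_lt ?_
  rw [lintegral_indicator_const measurableSet_closedBall]
  exact ENNReal.mul_lt_top ENNReal.ofReal_lt_top measure_closedBall_lt_top

theorem MemWeightedLp.conv [NormedAlgebra ℂ A] (hpq : p.HolderConjugate q)
    (hω : IsAlmostMonotoneAlgebraWeight q ω) (hf : MemWeightedLp p ω f)
    (hg : MemWeightedLp p ω g) : MemWeightedLp p ω (conv f g) := by
  obtain ⟨f', hf'm, hff', hf'⟩ := hf.exists_stronglyMeasurable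
  obtain ⟨g', hg'm, hgg', hg'⟩ := hg.exists_stronglyMeasurable
  have hi := (integrable_conv (hf'.integrable hpq hω) (hg'.integrable hpq hω)).1
  have hpos := hω.toIsWeight.pos
  rw [conv_congr hff' hgg']
  rw [memWeightedLp_iff hpq.pos hpos] at hf' hg' ⊢
  refine ⟨hi, lt_of_le_of_lt ?_ (ENNReal.mul_lt_top hf'.2 hg'.2)⟩
  refine le_trans ?_ (wnorm_lconv_le hpq hω hf'm.enorm hg'm.enorm 0)
  exact wnorm_mono_ae hpq.pos.le (Eventually.of_forall fun x => enorm_conv_le f' g' x) 0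

/-- The tails of a weighted `L^p` function tend to zero. -/
theorem tendsto_wnorm_indicator (hp : 0 < p) (hω : Measurable ω) {ρ : ℝ → ENNReal}
    (hρ : Measurable ρ) (h : wnorm p ω 0 ρ < ⊤) :
    Tendsto (fun n : ℕ => wnorm p ω 0 ({y : ℝ | (n : ℝ) < |y|}.indicator ρ)) atTop (𝓝 0) := by
  have hSm : ∀ n : ℕ, MeasurableSet {y : ℝ | (n : ℝ) < |y|} := fun n =>
    measurableSet_lt measurable_const (by fun_prop)
  rw [wnorm, ENNReal.rpow_lt_top_iff_of_pos (by positivity)] at h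
  have key := tendsto_lintegral_of_dominated_convergence (μ := volume)
    (F := fun (n : ℕ) x => ({y : ℝ | (n : ℝ) < |y|}.indicator ρ x *
      ENNReal.ofReal (ω (x - 0))) ^ p) (f := fun _ => 0)
    (fun x => (ρ x * ENNReal.ofReal (ω (x - 0))) ^ p)
    (fun n => by have := hρ.indicator (hSm n); fun_prop)
    (fun n => Eventually.of_forall fun x => ENNReal.rpow_le_rpow
      (mul_le_mul_left (Set.indicator_le_self _ _ x) _) hp.le) h.ne
    (Eventually.of_forall fun x => by
      obtain ⟨m, hm⟩ := exists_nat_ge |x|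
      refine tendsto_const_nhds.congr' ?_
      filter_upwards [eventually_ge_atTop m] with n hn
      rw [Set.indicator_of_notMem, zero_mul, ENNReal.zero_rpow_of_pos hp]
      have : (m : ℝ) ≤ n := by exact_mod_cast hn
      simpa using hm.trans this)
  rw [lintegral_zero] at key
  have h0 : (0 : ENNReal) = 0 ^ (1 / p) := by rw [ENNReal.zero_rpow_of_pos (by positivity)]
  rw [h0]
  exact (ENNReal.continuous_rpow_const.tendsto _).comp key

/-- The weights produced by `exists_small_weights`. -/
def IsSmallWeightFamily (q : ℝ) (ω : ℝ → ℝ) (ν : ℝ → ℝ → ℝ) : Prop :=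
  ∃ K > 0, ∀ᶠ ε in 𝓝[>] (0 : ℝ), IsAlmostMonotoneAlgebraWeight q (ν ε) ∧
    (∀ x, ν ε x ≤ K * ω x) ∧ (∃ C, ∀ x, ν ε x ≤ C * Real.exp (2 * ε * |x|)) ∧
    (IsAdmissible ω → ∀ x, ω x ≤ ν ε x)

theorem exists_isSmallWeightFamily (hq : 1 ≤ q) (hω : IsAlmostMonotoneAlgebraWeight q ω) :
    ∃ ν, IsSmallWeightFamily q ω ν := by
  obtain ⟨ν, K, hK, ε₀, hε₀, h⟩ := exists_small_weights hq hω
  refine ⟨ν, K, hK, ?_⟩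
  filter_upwards [Ioo_mem_nhdsGT hε₀] with ε hε
  exact h ε hε.1 hε.2

variable [NormedAlgebra ℂ A]

theorem eventually_memWeightedLp (hpq : p.HolderConjugate q)
    (hω : IsAlmostMonotoneAlgebraWeight q ω) {ν : ℝ → ℝ → ℝ} (hν : IsSmallWeightFamily q ω ν)
    {r h : ℝ → A} (hr : MemWeightedLp p ω r) (hr1 : ∫⁻ x, ‖r x‖ₑ < 1) (hh : Integrable h)
    (hrh : h + r + conv h r =ᵐ[volume] 0) :
    ∀ᶠ ε in 𝓝[>] (0 : ℝ), MemWeightedLp p (ν ε) h := by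
  obtain ⟨K, hK, hν⟩ := hν
  obtain ⟨r', hr'm, hrr', hr'⟩ := hr.exists_stronglyMeasurable
  obtain ⟨h', hh'm, hhh'⟩ := hh.1
  have hp := hpq.pos
  rw [memWeightedLp_iff hp hω.toIsWeight.pos] at hr'
  set ρ : ℝ → ENNReal := fun x => ‖r' x‖ₑ with hρ
  set H : ℝ → ENNReal := fun x => ‖h' x‖ₑ with hH
  have hρm : Measurable ρ := hr'm.enorm
  have hHm : Measurable H := hh'm.enorm
  have hρ1 : ∫⁻ x, ρ x < 1 :=
    lt_of_eq_of_lt (lintegral_congr_ae (EventuallyEq.fun_comp hrr' (‖·‖ₑ)).symm) hr1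
  have hHt : ∫⁻ x, H x < ⊤ :=
    lt_of_eq_of_lt (lintegral_congr_ae (EventuallyEq.fun_comp hhh' (‖·‖ₑ)).symm) hh.2
  have hle : H ≤ᵐ[volume] ρ + lconv ρ H := by
    filter_upwards [hrh, hrr', hhh'] with x h1 h2 h3
    have h4 : h' x = -(r' x + conv h' r' x) := by
      rw [conv_congr hhh' hrr'] at h1
      rw [Pi.add_apply, Pi.add_apply, Pi.zero_apply, h2, h3, add_assoc] at h1
      exact eq_neg_of_add_eq_zero_left h1
    calc H x = ‖r' x + conv h' r' x‖ₑ := by rw [hH]; simp only; rw [h4, enorm_neg]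
      _ ≤ ‖r' x‖ₑ + ‖conv h' r' x‖ₑ := enorm_add_le _ _
      _ ≤ ρ x + lconv H ρ x := add_le_add le_rfl (enorm_conv_le h' r' x)
      _ = (ρ + lconv ρ H) x := by rw [lconv_comm H ρ]; rfl
  set a := ∫⁻ x, ρ x with ha
  -- The room below one is split at `b`. As `K` does not depend on `ε`, the cut `n` is fixed first,
  -- with tail below `1 - b`; then `ε` is made small enough that `e^{2εn}` keeps the near part below
  -- `b`.
  obtain ⟨b, hab, hb1⟩ := exists_between hρ1
  have hKt : Tendsto (fun n : ℕ => ENNReal.ofReal K *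
      wnorm p ω 0 ({y : ℝ | (n : ℝ) < |y|}.indicator ρ)) atTop (𝓝 (ENNReal.ofReal K * 0)) :=
    ENNReal.Tendsto.const_mul (tendsto_wnorm_indicator hp hω.measurable hρm hr'.2)
      (Or.inr ENNReal.ofReal_ne_top)
  rw [mul_zero] at hKt
  obtain ⟨n, hn⟩ := (hKt.eventually_lt_const (tsub_pos_of_lt hb1)).exists
  have hexp : Tendsto (fun ε : ℝ => ENNReal.ofReal (Real.exp (2 * ε * n)) * a) (𝓝 0)
      (𝓝 (ENNReal.ofReal (Real.exp (2 * 0 * n)) * a)) := by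
    refine ENNReal.Tendsto.mul_const ?_ (Or.inl ?_)
    · exact (ENNReal.continuous_ofReal.comp (by fun_prop : Continuous fun ε : ℝ =>
        Real.exp (2 * ε * n))).tendsto 0
    · simp
  rw [mul_zero, zero_mul, Real.exp_zero, ENNReal.ofReal_one, one_mul] at hexp
  filter_upwards [hν, nhdsWithin_le_nhds (hexp.eventually_lt_const hab), self_mem_nhdsWithin]
    with ε hε hεn hε0
  obtain ⟨hν1, hν2, ⟨C, hC⟩, -⟩ := hε
  refine MemWeightedLp.congr_ae ?_ hhh'.symm
  rw [memWeightedLp_iff hp hν1.toIsWeight.pos]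
  refine ⟨hh'm.aestronglyMeasurable, ?_⟩
  refine wnorm_lt_top_of_le hpq hν1 hρm hHm hρ1 hHt hle (N := n)
    (mul_nonneg zero_le_two (le_of_lt hε0)) hC ?_ ?_
  · exact (wnorm_le_of_le hp hK.le hν2 0 _).trans_lt
      (ENNReal.mul_lt_top ENNReal.ofReal_lt_top hr'.2)
  · have h5 := (wnorm_le_of_le hp hK.le hν2 0 ({y : ℝ | (n : ℝ) < |y|}.indicator ρ)).trans_lt hn
    refine (ENNReal.add_lt_add hεn h5).trans_le ?_
    rw [add_tsub_cancel_of_le hb1.le]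

end Membership

/-! ### Assembly of left, right and two-sided inverses. -/

section Main

open Topology MulOpposite

variable {A : Type*} [NormedRing A] {p q : ℝ} {ω : ℝ → ℝ}

/-- One good `ε` is selected. In the admissible case `ω ≤ ν ε`, so the same `g` already lies in
`L^p(ω)`. `Q` stands for any of the three kinds of inverse. -/
theorem exists_weight_of_eventually (hp : 0 < p) (hω : IsAlmostMonotoneAlgebraWeight q ω)
    {ν : ℝ → ℝ → ℝ} (hν : IsSmallWeightFamily q ω ν)
    {Q : (ℝ → A) × ℂ → Prop}
    (h : ∀ᶠ ε in 𝓝[>] (0 : ℝ), IsAlmostMonotoneAlgebraWeight q (ν ε) →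
      ∃ g : ℝ → A, MemWeightedLp p (ν ε) g ∧ Q (onePlus g)) :
    (∃ (ν : ℝ → ℝ) (g : ℝ → A), IsAlmostMonotoneAlgebraWeight q ν ∧ MemWeightedLp p ν g ∧
        (∃ K : ℝ, 0 < K ∧ ∀ x, 1 ≤ ν x ∧ ν x ≤ K * ω x) ∧ Q (onePlus g)) ∧
      (IsAdmissible ω → ∃ u, MemUnitization p ω u ∧ Q u) := by
  obtain ⟨K, hK, hν⟩ := hν
  obtain ⟨ε, h1, h2⟩ := (h.and hν).exists
  obtain ⟨g, hg, hQ⟩ := h1 h2.1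
  refine ⟨⟨ν ε, g, h2.1, hg, ⟨K, hK, fun x => ⟨h2.1.one_le x, h2.2.1 x⟩⟩, hQ⟩,
    fun had => ⟨onePlus g, ?_, hQ⟩⟩
  exact hg.mono_weight hp h2.1.toIsWeight.pos hω.toIsWeight.pos zero_le_one
    fun x => by simpa using h2.2.2.2 had x

theorem memWeightedLp_op {f : ℝ → A} (hf : MemWeightedLp p ω f) :
    MemWeightedLp p ω fun x => op (f x) :=
  ⟨continuous_op.comp_aestronglyMeasurable hf.1, hf.2⟩

theorem memWeightedLp_unop {f : ℝ → Aᵐᵒᵖ} (hf : MemWeightedLp p ω f) :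
    MemWeightedLp p ω fun x => unop (f x) :=
  ⟨continuous_unop.comp_aestronglyMeasurable hf.1, hf.2⟩

variable [NormedAlgebra ℂ A]

theorem conv_op (f g : ℝ → A) :
    conv (fun x => op (f x)) (fun x => op (g x)) = fun x => op (conv g f x) := by
  ext x
  rw [conv_apply, conv_apply, ← integral_sub_left_eq_self _ volume x]
  have h := (opContinuousLinearEquiv ℂ (M := A)).integral_comp_comm (μ := volume)
    (fun y => g y * f (x - y))
  simpa using h

theorem symbol_op (f : ℝ → A) (t : ℝ) : symbol (fun x => op (f x)) t = op (symbol f t) := by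
  have h := (opContinuousLinearEquiv ℂ (M := A)).integral_comp_comm (μ := volume)
    (fun x : ℝ => Complex.exp (Complex.I * t * x) • f x)
  rw [symbol, symbol, op_add, op_one]
  congr 1

theorem isLeftInv_onePlus_iff {f g : ℝ → A} :
    IsLeftInv (onePlus g) (onePlus f) ↔ g + f + conv g f =ᵐ[volume] 0 := by
  simp only [IsLeftInv, UnitEq, unitMul, onePlus, unitOne, one_smul, mul_one, and_true]
  rw [show conv g f + f + g = g + f + conv g f by abel]

theorem isRightInv_onePlus_iff {f g : ℝ → A} :
    IsRightInv (onePlus g) (onePlus f) ↔ f + g + conv f g =ᵐ[volume] 0 := by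
  rw [← isLeftInv_onePlus_iff]
  rfl

theorem symbol_congr {f g : ℝ → A} (h : f =ᵐ[volume] g) (t : ℝ) : symbol f t = symbol g t := by
  unfold symbol
  congr 1
  refine integral_congr_ae ?_
  filter_upwards [h] with x hx
  rw [hx]

theorem coeFn_add_add_convL1 (f g : L1 A) :
    ⇑(g + f + convL1 g f) =ᵐ[volume] ⇑g + ⇑f + conv g f := by
  filter_upwards [Lp.coeFn_add (g + f) (convL1 g f), Lp.coeFn_add g f, coeFn_convL1 g f]
    with x h1 h2 h3
  rw [h1, Pi.add_apply, h2, h3]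
  rfl

variable [CompleteSpace A]

theorem eventually_exists_leftInverse (hpq : p.HolderConjugate q)
    (hω : IsAlmostMonotoneAlgebraWeight q ω) {ν : ℝ → ℝ → ℝ} (hν : IsSmallWeightFamily q ω ν)
    {f : ℝ → A} (hf : MemWeightedLp p ω f) (hsymb : ∀ t : ℝ, ∃ b : A, b * symbol f t = 1) :
    ∀ᶠ ε in 𝓝[>] (0 : ℝ), ∃ g : ℝ → A, MemWeightedLp p (ν ε) g ∧
      g + f + conv g f =ᵐ[volume] 0 := by
  have hp := hpq.pos
  have hpos := hω.toIsWeight.pos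
  have hfi := hf.integrable hpq hω
  set F : L1 A := hfi.toL1 f with hF
  have hFf : F =ᵐ[volume] f := hfi.coeFn_toL1
  obtain ⟨G₀, hG₀⟩ := exists_leftInverse_L1 F fun t => by
    rw [symbol_congr hFf]
    exact hsymb t
  -- This accuracy gives `‖r‖ ≤ 1/2`, since `r` equals `(G₁ - G₀)(𝟏 + F)`.
  have hη : 0 < (2 * (1 + ‖F‖))⁻¹ := by positivity
  obtain ⟨g₁, hg₁c, hg₁, hg₁', hg₁i⟩ :=
    (L1.integrable G₀).exists_hasCompactSupport_lintegral_sub_le (ENNReal.ofReal_pos.2 hη).ne'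
  set G₁ : L1 A := hg₁i.toL1 g₁ with hG₁
  have hGg : G₁ =ᵐ[volume] g₁ := hg₁i.coeFn_toL1
  have hnorm : ‖G₁ - G₀‖ ≤ (2 * (1 + ‖F‖))⁻¹ := by
    rw [norm_sub_rev]
    refine L1.norm_le_of_lintegral_le hη.le (le_trans (le_of_eq (lintegral_congr_ae ?_)) hg₁)
    filter_upwards [Lp.coeFn_sub G₀ G₁, hGg] with x h1 h2
    rw [h1, Pi.sub_apply, h2]
  set r : L1 A := G₁ + F + convL1 G₁ F with hr
  have hr1 : ‖r‖ < 1 := by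
    have h1 : r = (G₁ - G₀) + convL1 (G₁ - G₀) F := by
      rw [map_sub, LinearMap.sub_apply, ← sub_zero r, ← hG₀, hr]
      abel
    calc ‖r‖ ≤ ‖G₁ - G₀‖ + ‖G₁ - G₀‖ * ‖F‖ := by
          rw [h1]
          exact (norm_add_le _ _).trans (add_le_add le_rfl (norm_convL1_le _ _))
      _ = ‖G₁ - G₀‖ * (1 + ‖F‖) := by ring
      _ ≤ (2 * (1 + ‖F‖))⁻¹ * (1 + ‖F‖) := mul_le_mul_of_nonneg_right hnorm (by positivity)
      _ = 1 / 2 := by field_simp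
      _ < 1 := by norm_num
  obtain ⟨U, hU⟩ := exists_one_add_mul_eq_one (R := L1 A →L[ℂ] L1 A)
    ((norm_rconv_le r).trans_lt hr1)
  set h : L1 A := U (-r) with hh
  have hhr : h + r + convL1 h r = 0 := by
    have := congrArg (fun T : L1 A →L[ℂ] L1 A => T (-r)) hU
    replace this : h + convL1 h r = -r := this
    rw [add_right_comm, this, neg_add_cancel]
  -- Compact support matters here: local boundedness of `ω` puts `g₁`, and hence `r`, into `L^p(ω)`.
  have hg₁m : MemWeightedLp p ω g₁ := memWeightedLp_of_hasCompactSupport hp hω.toIsWeight hg₁' hg₁c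
  have hrm : MemWeightedLp p ω r := by
    refine MemWeightedLp.congr_ae (f := g₁ + f + conv g₁ f)
      ((hg₁m.add hpq.lt.le hω.toIsWeight hf).add hpq.lt.le hω.toIsWeight
        (hg₁m.conv hpq hω hf)) ?_
    refine EventuallyEq.trans ?_ (coeFn_add_add_convL1 F G₁).symm
    rw [conv_congr hGg hFf]
    exact ((hGg.add hFf).add (ae_eq_refl _)).symm
  have hr1' : ∫⁻ x, ‖r x‖ₑ < 1 := by
    rw [← L1.ofReal_norm, ENNReal.ofReal_lt_one]
    exact hr1
  have hhr' : ⇑h + ⇑r + conv h r =ᵐ[volume] 0 := by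
    refine (coeFn_add_add_convL1 r h).symm.trans ?_
    rw [hhr]
    exact Lp.coeFn_zero _ _ _
  have hev := eventually_memWeightedLp hpq hω hν hrm hr1' (L1.integrable h) hhr'
  obtain ⟨K, hK, hν⟩ := hν
  filter_upwards [hev, hν] with ε hhm hε
  have hw := hε.1.toIsWeight
  have hg₁m' : MemWeightedLp p (ν ε) G₁ :=
    (hg₁m.mono_weight hp hpos hw.pos hK.le hε.2.1).congr_ae hGg.symm
  refine ⟨⇑(h + G₁ + convL1 h G₁), ?_, ?_⟩
  · exact ((hhm.add hpq.lt.le hw hg₁m').add hpq.lt.le hw (hhm.conv hpq hε.1 hg₁m')).congr_ae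
      (coeFn_add_add_convL1 G₁ h).symm
  · set G : L1 A := h + G₁ + convL1 h G₁ with hG
    -- By associativity, `(𝟏 + h)(𝟏 + G₁)(𝟏 + F) = (𝟏 + h)(𝟏 + r) = 𝟏`.
    have hzero : G + F + convL1 G F = 0 := by
      rw [← hhr, hG, hr]
      simp only [map_add, LinearMap.add_apply, convL1_assoc]
      abel
    rw [conv_congr (ae_eq_refl G) hFf.symm]
    refine ((ae_eq_refl G).add hFf.symm |>.add (ae_eq_refl _)).trans ?_
    refine (coeFn_add_add_convL1 F G).symm.trans ?_
    rw [hzero]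
    exact Lp.coeFn_zero _ _ _

/-- Passing to `Aᵐᵒᵖ` reverses convolutions and preserves norms, hence exchanges left and right
inverses. -/
theorem eventually_exists_rightInverse (hpq : p.HolderConjugate q)
    (hω : IsAlmostMonotoneAlgebraWeight q ω) {ν : ℝ → ℝ → ℝ} (hν : IsSmallWeightFamily q ω ν)
    {f : ℝ → A} (hf : MemWeightedLp p ω f) (hsymb : ∀ t : ℝ, ∃ b : A, symbol f t * b = 1) :
    ∀ᶠ ε in 𝓝[>] (0 : ℝ), ∃ g : ℝ → A, MemWeightedLp p (ν ε) g ∧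
      f + g + conv f g =ᵐ[volume] 0 := by
  have h := eventually_exists_leftInverse hpq hω hν (memWeightedLp_op hf) fun t => by
    obtain ⟨b, hb⟩ := hsymb t
    exact ⟨op b, by rw [symbol_op, ← op_mul, hb, op_one]⟩
  filter_upwards [h] with ε hε
  obtain ⟨g, hg, hgf⟩ := hε
  refine ⟨fun x => unop (g x), memWeightedLp_unop hg, ?_⟩
  have hc : conv g (fun x => op (f x)) = fun x => op (conv f (fun x => unop (g x)) x) :=
    conv_op (fun x => unop (g x)) f
  rw [hc] at hgf
  filter_upwards [hgf] with x hx
  have := congrArg unop hx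
  simp only [Pi.add_apply, unop_add, unop_op, Pi.zero_apply, unop_zero] at this
  simpa [add_comm (f x)] using this

/-- Left and right inverses of `𝟏 + f` coincide. -/
theorem leftInverse_ae_eq_rightInverse {f g h : ℝ → A} (hf : Integrable f) (hg : Integrable g)
    (hh : Integrable h) (hgf : g + f + conv g f =ᵐ[volume] 0)
    (hfh : f + h + conv f h =ᵐ[volume] 0) : g =ᵐ[volume] h := by
  have key : ∀ {u v : ℝ → A} (hu : Integrable u) (hv : Integrable v) (U V : L1 A),
      U = hu.toL1 u → V = hv.toL1 v → u + v + conv u v =ᵐ[volume] 0 →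
      U + V + convL1 U V = 0 := by
    rintro u v hu hv _ _ rfl rfl h
    refine Lp.ext ((coeFn_add_add_convL1 _ _).trans (EventuallyEq.trans ?_
      (Lp.coeFn_zero _ _ _).symm))
    rw [conv_congr hu.coeFn_toL1 hv.coeFn_toL1]
    exact ((hu.coeFn_toL1.add hv.coeFn_toL1).add (ae_eq_refl _)).trans h
  let F : L1 A := hf.toL1 f
  let G : L1 A := hg.toL1 g
  let H : L1 A := hh.toL1 h
  have h1 := key hg hf G F rfl rfl hgf
  have h2 := key hf hh F H rfl rfl hfh
  have h3 : G = H := by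
    have e1 : convL1 (G + F + convL1 G F) H = 0 := by rw [h1]; simp
    have e2 : convL1 G (F + H + convL1 F H) = 0 := by rw [h2]; simp
    simp only [map_add, LinearMap.add_apply, convL1_assoc] at e1 e2
    have e3 : convL1 G F = convL1 F H := by
      rw [← sub_eq_zero, ← sub_zero (convL1 G F - convL1 F H), ← sub_self (0 : L1 A)]
      nth_rewrite 2 [← e1]
      rw [← e2]
      abel
    have e4 : G + F + convL1 G F = F + H + convL1 G F := by rw [h1, e3, h2]
    rw [add_comm G F] at e4
    exact add_left_cancel (add_right_cancel e4)
  exact (Integrable.toL1_eq_toL1_iff _ _ hg hh).1 h3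

end Main

end WienerLp

end

open WienerLp in
theorem theorem1p4 {A : Type*} [NormedRing A] [NormedAlgebra ℂ A] [CompleteSpace A]
    (p q : ℝ) (hp : 1 < p) (hpq : 1 / p + 1 / q = 1)
    (ω : ℝ → ℝ) (hω : IsAlmostMonotoneAlgebraWeight q ω)
    (f : ℝ → A) (hf : MemWeightedLp p ω f) :
    -- left invertibility
    ((∀ t : ℝ, ∃ b : A, b * symbol f t = 1) →
      (∃ (ν : ℝ → ℝ) (g : ℝ → A), IsAlmostMonotoneAlgebraWeight q ν ∧ MemWeightedLp p ν g ∧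
        (∃ K : ℝ, 0 < K ∧ ∀ x, 1 ≤ ν x ∧ ν x ≤ K * ω x) ∧
        IsLeftInv (onePlus g) (onePlus f)) ∧
      (IsAdmissible ω → ∃ u, MemUnitization p ω u ∧ IsLeftInv u (onePlus f))) ∧
    -- right invertibility
    ((∀ t : ℝ, ∃ b : A, symbol f t * b = 1) →
      (∃ (ν : ℝ → ℝ) (g : ℝ → A), IsAlmostMonotoneAlgebraWeight q ν ∧ MemWeightedLp p ν g ∧
        (∃ K : ℝ, 0 < K ∧ ∀ x, 1 ≤ ν x ∧ ν x ≤ K * ω x) ∧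
        IsRightInv (onePlus g) (onePlus f)) ∧
      (IsAdmissible ω → ∃ u, MemUnitization p ω u ∧ IsRightInv u (onePlus f))) ∧
    -- two-sided invertibility
    ((∀ t : ℝ, IsUnit (symbol f t)) →
      (∃ (ν : ℝ → ℝ) (g : ℝ → A), IsAlmostMonotoneAlgebraWeight q ν ∧ MemWeightedLp p ν g ∧
        (∃ K : ℝ, 0 < K ∧ ∀ x, 1 ≤ ν x ∧ ν x ≤ K * ω x) ∧
        IsTwoSidedInv (onePlus g) (onePlus f)) ∧
      (IsAdmissible ω → ∃ u, MemUnitization p ω u ∧ IsTwoSidedInv u (onePlus f))) := by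
  have hpq' : p.HolderConjugate q := Real.holderConjugate_iff.2 ⟨hp, by simpa using hpq⟩
  have hp0 : 0 < p := one_pos.trans hp
  obtain ⟨ν, hν⟩ := exists_isSmallWeightFamily hpq'.symm.lt.le hω
  refine ⟨fun h => ?_, fun h => ?_, fun h => ?_⟩
  · refine exists_weight_of_eventually hp0 hω hν (Q := fun u => IsLeftInv u (onePlus f)) ?_
    filter_upwards [eventually_exists_leftInverse hpq' hω hν hf h] with ε hε _
    obtain ⟨g, hg, hgf⟩ := hε
    exact ⟨g, hg, isLeftInv_onePlus_iff.2 hgf⟩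
  · refine exists_weight_of_eventually hp0 hω hν (Q := fun u => IsRightInv u (onePlus f)) ?_
    filter_upwards [eventually_exists_rightInverse hpq' hω hν hf h] with ε hε _
    obtain ⟨g, hg, hgf⟩ := hε
    exact ⟨g, hg, isRightInv_onePlus_iff.2 hgf⟩
  · refine exists_weight_of_eventually hp0 hω hν (Q := fun u => IsTwoSidedInv u (onePlus f)) ?_
    -- Both constructions work for all small `ε`, so a common weight serves the left and the right
    -- inverse, which then coincide.
    filter_upwards [
      eventually_exists_leftInverse hpq' hω hν hf fun t => (h t).exists_left_inv,
      eventually_exists_rightInverse hpq' hω hν hf fun t => (h t).exists_right_inv]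
      with ε hl hr hw
    obtain ⟨g, hg, hgf⟩ := hl
    obtain ⟨k, hk, hfk⟩ := hr
    have hgk := leftInverse_ae_eq_rightInverse (hf.integrable hpq' hω) (hg.integrable hpq' hw)
      (hk.integrable hpq' hw) hgf hfk
    refine ⟨g, hg, isLeftInv_onePlus_iff.2 hgf, isRightInv_onePlus_iff.2 ?_⟩
    rw [conv_congr (ae_eq_refl f) hgk]
    exact (((ae_eq_refl f).add hgk).add (ae_eq_refl _)).trans hfk
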